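/- Let $g,k,n\ge 0$ be integers and let $\boldsymbol\mu=(\mu^1,\dots,\mu^k)$ be a $k$-tuple of partitions of $n$, $\mu^i=(\mu^i_1\ge\mu^i_2\ge\cdots)$. Put $$\Delta(\boldsymbol\mu)=\tfrac12(2g-2+k)n^2-\tfrac12\sum_{i,j}(\mu^i_j)^2,\qquad \delta(\boldsymbol\mu)=(2g-2+k)n-\sum_{i=1}^k\mu^i_1 .$$ For a partition $\lambda$ of $n$ let $n(\lambda)=\sum_i(i-1)\lambda_i$, let $H_\lambda(q)=\prod_{s\in\lambda}(1-q^{h(s)})$ be the hook polynomial ($h(s)$ the hook length of the cell $s$), and let $$\mathcal A_{\lambda\boldsymbol\mu}(q)=q^{(1-g)n}\left(q^{-n(\lambda)}H_\lambda(q)\right)^{2g+k-2}\prod_{i=1}^k\left\langle h_{\mu^i}(\mathbf x_i),\,s_\lambda(\mathbf x_i\mathbf y)\right\rangle ,$$ where $\langle\cdot,\cdot\rangle$ is the Hall pairing on symmetric functions in infinitely many variables, $h_\mu$ and $s_\lambda$ are the complete and the Schur symmetric functions, and $\mathbf x\mathbf y$ is the set of variables $x_iy_j$ ($i,j\ge1$)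 with $y_j=q^{j-1}$; $\mathcal A_{\lambda\boldsymbol\mu}(q)$ is expanded as a Laurent series in $q$ over $\mathbb Q$. Let $v(\lambda)\in\mathbb Z$ be the $q$-adic valuation of $\mathcal A_{\lambda\boldsymbol\mu}(q)$. Let $\Gamma$ be the comet-shaped quiver with $g$ loops at a central vertex $0$ and $k$ legs with vertices $[i,1],\dots,[i,l(\mu^i)-1]$ ($l(\mu^i)$ the number of parts of $\mu^i$; no vertices if $l(\mu^i)\le 1$), and let $\mathbf v$ be its dimension vector $v_0=n$, $v_{[i,j]}=n-\sum_{r=1}^j\mu^i_r$. The quiver $\Gamma$, which is connected, is affine if its Tits form is positive semidefinite but not positive definite; its basic positive imaginary root $\mathbf v^*$ is then the vector such that the positive imaginary roots of $\Gamma$ (in the sense of Kac) are exactly the vectors $t\mathbf v^*$, $t\ge1$ an integer. Assume $\delta(\boldsymbol\mu)\ge0$. Then $\mathcal A_{\lambda\boldsymbol\mu}(q)\ne0$ for every partition $\lambda$ of $n$, and: (i) The minimum of $v(\lambda)$ over all partitions $\lambda$ of $n$ is $v((1^n))=-\Delta(\boldsymbol\mu)$. (ii) Case I: if $\Gamma$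 is affine and $\mathbf v=t\mathbf v^*$ for an integer $t\ge1$, then $t\mid n$ and the minimum is reached exactly at the partitions $\lambda$ that are the union of $n/t$ copies of some partition $\lambda_0$ of $t$. Case II: otherwise, the minimum is reached only at $\lambda=(1^n)$. -/

import Mathlib

namespace SymFun

/-! ### Partitions -/

section Partitions

variable {n : ℕ}

/-- The parts `λ_1 ≥ λ_2 ≥ …` of a partition, in weakly decreasing order. -/
def rows (lam : n.Partition) : List ℕ := lam.parts.sort (· ≥ ·)

theorem rows_sortedGE (lam : n.Partition) : (rows lam).SortedGE :=
  List.sortedGE_iff_pairwise.2 (Multiset.pairwise_sort _ _)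

/-- The part with (zero-based) index `j`; it is `0` beyond the length. -/
def part (lam : n.Partition) (j : ℕ) : ℕ := (rows lam).getD j 0

/-- The Young diagram of a partition; row `i` has `part lam i` cells. -/
def diagram (lam : n.Partition) : YoungDiagram :=
  YoungDiagram.ofRowLens (rows lam) (rows_sortedGE lam)

/-- `n(λ) = ∑ (i - 1) λ_i`, `i` counted from `1`. -/
def nStat (lam : n.Partition) : ℕ := ∑ i ∈ Finset.range (rows lam).length, i * part lam i

/-- The partition `(1^n)`. -/
def ones (n : ℕ) : n.Partition := Nat.Partition.ofSums n (Multiset.replicate n 1) (by simp)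

/-- Hook length of the cell `(i, j)`: arm plus leg plus one. -/
def hookLength (D : YoungDiagram) (c : ℕ × ℕ) : ℕ :=
  (D.rowLen c.1 - (c.2 + 1)) + (D.colLen c.2 - (c.1 + 1)) + 1

/-- The exponent vector of the monomial `x^λ = x_0^{λ_1} x_1^{λ_2} ⋯`. -/
noncomputable def exponent (lam : n.Partition) : ℕ →₀ ℕ := (rows lam).toFinsupp

end Partitions

/-! ### Symmetric functions in infinitely many variables

Symmetric functions are formal power series in variables `x_0, x_1, …`. -/

section SymmetricFunctions

open Finset

variable (K : Type*) [Field K]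

/-- The complete symmetric function `h_r` in the variables `x_0, x_1, …`: the sum of all monomials
of degree `r`. -/
noncomputable def completeH (r : ℕ) : MvPowerSeries ℕ K := fun d => if d.degree = r then 1 else 0

open Classical in
/-- The power sum `p_r = ∑ x_i ^ r`. -/
noncomputable def powerSum (r : ℕ) : MvPowerSeries ℕ K :=
  fun d => if ∃ i, d = Finsupp.single i r then 1 else 0

/-- `h_ν = ∏ h_{ν_j}` for a partition `ν`. -/
noncomputable def completeHPart {n : ℕ} (ν : n.Partition) : MvPowerSeries ℕ K :=
  (ν.parts.map (completeH K)).prod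

variable {K}

theorem coeff_completeH (r : ℕ) (d : ℕ →₀ ℕ) :
    MvPowerSeries.coeff d (completeH K r) = if d.degree = r then 1 else 0 := rfl

open Classical in
theorem coeff_powerSum (r : ℕ) (d : ℕ →₀ ℕ) :
    MvPowerSeries.coeff d (powerSum K r) = if ∃ i, d = Finsupp.single i r then 1 else 0 := rfl

theorem coeff_powerSum_mul (r : ℕ) (d : ℕ →₀ ℕ) (f : MvPowerSeries ℕ K) :
    MvPowerSeries.coeff d (powerSum K (r + 1) * f) = ∑ i ∈ d.support,
      if r + 1 ≤ d i then MvPowerSeries.coeff (d - Finsupp.single i (r + 1)) f else 0 := by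
  classical
  rw [MvPowerSeries.coeff_mul, ← Finset.sum_filter]
  symm
  have hsub : (d.support.filter (fun i => r + 1 ≤ d i)).image
      (fun i => (Finsupp.single i (r + 1), d - Finsupp.single i (r + 1)))
      ⊆ antidiagonal d := by
    intro x hx
    simp only [mem_image, mem_filter] at hx
    obtain ⟨i, ⟨_, hi⟩, rfl⟩ := hx
    rw [Finset.HasAntidiagonal.mem_antidiagonal]
    exact add_tsub_cancel_of_le (Finsupp.single_le_iff.2 hi)
  rw [← Finset.sum_subset hsub, Finset.sum_image]
  · refine Finset.sum_congr rfl fun i _ => ?_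
    rw [coeff_powerSum, if_pos ⟨i, rfl⟩, one_mul]
  · intro i _ j _ hij
    exact Finsupp.single_left_injective (Nat.succ_ne_zero r) (congrArg Prod.fst hij)
  · rintro ⟨a, b⟩ hab hn
    rw [coeff_powerSum, if_neg, zero_mul]
    rintro ⟨i, hi⟩
    apply hn
    simp only at hi
    subst hi
    rw [Finset.HasAntidiagonal.mem_antidiagonal] at hab
    simp only at hab
    simp only [mem_image, mem_filter]
    refine ⟨i, ⟨?_, ?_⟩, ?_⟩
    · rw [Finsupp.mem_support_iff, ← hab]; simp
    · rw [← hab]; simp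
    · rw [← hab, add_tsub_cancel_left]

theorem newton (n : ℕ) :
    ((n : K) + 1) • completeH K (n + 1) =
      ∑ r ∈ range (n + 1), powerSum K (r + 1) * completeH K (n - r) := by
  ext d
  rw [map_sum, map_smul, coeff_completeH]
  simp_rw [coeff_powerSum_mul, coeff_completeH]
  rw [Finset.sum_comm]
  have hdeg : ∀ i r, r + 1 ≤ d i → (d - Finsupp.single i (r + 1)).degree + (r + 1) = d.degree := by
    intro i r hr
    conv_rhs => rw [← tsub_add_cancel_of_le (Finsupp.single_le_iff.2 hr)]
    simp
  split_ifs with h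
  · have : ∀ i ∈ d.support, (∑ r ∈ range (n + 1), if r + 1 ≤ d i then
        (if (d - Finsupp.single i (r + 1)).degree = n - r then (1 : K) else 0) else 0) = d i := by
      intro i _
      have hle : d i ≤ n + 1 := h ▸ Finsupp.le_degree i d
      rw [← Finset.sum_subset (s₁ := range (d i)) (Finset.range_subset_range.2 hle)]
      · rw [Finset.sum_congr rfl (g := fun _ => 1)]
        · simp
        · intro r hr
          have hr' : r + 1 ≤ d i := by simpa using hr
          have := hdeg i r hr'
          rw [if_pos hr', if_pos (by omega)]
      · intro r _ hr
        rw [if_neg (by simpa using hr)]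
    rw [Finset.sum_congr rfl this, ← Nat.cast_sum]
    have : ∑ i ∈ d.support, d i = n + 1 := h
    rw [this]; simp
  · symm
    rw [smul_zero]
    refine Finset.sum_eq_zero fun i _ => Finset.sum_eq_zero fun r hr => ?_
    split_ifs with h1 h2
    · have := hdeg i r h1
      have : r ≤ n := by simpa [Nat.lt_succ_iff] using hr
      omega
    · rfl
    · rfl

/-- The multiset of nonzero values of an exponent vector. -/
def vals (d : ℕ →₀ ℕ) : Multiset ℕ := d.support.val.map d

theorem vals_erase (d : ℕ →₀ ℕ) (i : ℕ) (hi : i ∈ d.support) :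
    vals d = d i ::ₘ vals (d.erase i) := by
  classical
  unfold vals
  rw [Finsupp.support_erase, ← Finset.insert_erase hi, Finset.insert_val_of_notMem (by simp)]
  rw [Finset.insert_erase hi, Multiset.map_cons]
  congr 1
  refine Multiset.map_congr rfl fun j hj => ?_
  have : j ≠ i := (Finset.mem_erase.1 hj).1
  rw [Finsupp.erase_ne this]

theorem exists_vals (s : Multiset ℕ) (hs : ∀ a ∈ s, 0 < a) : ∃ d, vals d = s := by
  induction s using Multiset.induction with
  | empty => exact ⟨0, by simp [vals]⟩
  | cons a s ih =>
    obtain ⟨d, hd⟩ := ih fun b hb => hs b (Multiset.mem_cons_of_mem hb)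
    obtain ⟨i, hi⟩ := Infinite.exists_notMem_finset d.support
    have ha : a ≠ 0 := (hs a (Multiset.mem_cons_self a s)).ne'
    have hdi : d i = 0 := by simpa using hi
    refine ⟨d + Finsupp.single i a, ?_⟩
    rw [vals_erase _ i (by simp [ha]), Finsupp.erase_add, Finsupp.erase_single, add_zero,
      Finsupp.erase_of_notMem_support hi, hd]
    simp [hdi]

theorem coeff_prod_powerSum (s : Multiset ℕ) : ∀ d : ℕ →₀ ℕ, ∃ N : ℕ,
    MvPowerSeries.coeff d (s.map fun i => powerSum K (i + 1)).prod = (N : K) ∧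
    (vals d = s.map (· + 1) → 0 < N) ∧
    (0 < N → (vals d).card ≤ s.card ∧ ((vals d).card = s.card → vals d = s.map (· + 1))) := by
  classical
  induction s using Multiset.induction with
  | empty =>
    intro d
    refine ⟨if d = 0 then 1 else 0, ?_, ?_, ?_⟩
    · simp [MvPowerSeries.coeff_one]
    · intro h
      have : d = 0 := by simpa [vals] using h
      simp [this]
    · intro h
      have : d = 0 := by by_contra hne; simp [hne] at h
      simp [this, vals]
  | cons a s ih =>
    intro d
    choose N h1 h2 h3 using ih
    refine ⟨∑ i ∈ d.support, if a + 1 ≤ d i then N (d - Finsupp.single i (a + 1)) else 0, ?_, ?_, ?_⟩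
    · rw [Multiset.map_cons, Multiset.prod_cons, coeff_powerSum_mul, Nat.cast_sum]
      refine Finset.sum_congr rfl fun i _ => ?_
      split_ifs <;> simp [h1]
    · intro h
      have hm : a + 1 ∈ vals d := by rw [h]; simp
      obtain ⟨i, hi, hia⟩ := Multiset.mem_map.1 hm
      have hi' : i ∈ d.support := hi
      refine lt_of_lt_of_le ?_ (Finset.single_le_sum (f := fun i =>
        if a + 1 ≤ d i then N (d - Finsupp.single i (a + 1)) else 0) (fun _ _ => Nat.zero_le _) hi')
      rw [if_pos hia.ge]
      apply h2
      have he : d - Finsupp.single i (a + 1) = d.erase i := by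
        ext j
        by_cases hj : j = i
        · subst hj; simp [hia]
        · simp [Finsupp.erase_ne hj, Finsupp.single_eq_of_ne hj]
      rw [he]
      have := vals_erase d i hi'
      rw [h, hia, Multiset.map_cons] at this
      exact ((Multiset.cons_inj_right _).1 this).symm
    · intro h
      obtain ⟨i, hi, hpos⟩ := Finset.sum_pos_iff.1 h
      split_ifs at hpos with hle
      · obtain ⟨hc, he⟩ := h3 _ hpos
        set d' := d - Finsupp.single i (a + 1) with hd'
        have hv := vals_erase d i hi
        have herase : d'.erase i = d.erase i := by
          ext j
          by_cases hj : j = i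
          · subst hj; simp
          · simp [Finsupp.erase_ne hj, hd', Finsupp.single_eq_of_ne hj]
        by_cases hi' : i ∈ d'.support
        · have hv' := vals_erase d' i hi'
          rw [herase] at hv'
          have hcard : (vals d).card = (vals d').card := by rw [hv, hv']; simp
          constructor
          · rw [hcard, Multiset.card_cons]; omega
          · intro hh; rw [hcard, Multiset.card_cons] at hh; omega
        · rw [Finsupp.erase_of_notMem_support hi'] at herase
          have hdi : d i = a + 1 := by
            have : d' i = 0 := by simpa using hi'
            have h0 : d i - (a + 1) = 0 := by simpa [hd'] using this
            omega
          rw [hv, ← herase, hdi]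
          simp only [Multiset.card_cons, Multiset.map_cons]
          refine ⟨by omega, fun hh => ?_⟩
          rw [he (by omega)]
      · exact absurd hpos (lt_irrefl _)

theorem aeval_monomial_eq (F : ℕ → MvPowerSeries ℕ K) (β : ℕ →₀ ℕ) (c : K) :
    MvPolynomial.aeval F (MvPolynomial.monomial β c) = c • (β.toMultiset.map F).prod := by
  rw [MvPolynomial.aeval_monomial, Algebra.smul_def]
  congr 1
  rw [Finsupp.toMultiset_apply, Finsupp.sum, ← Multiset.coe_mapAddMonoidHom, map_sum,
    Multiset.prod_sum]
  refine Finset.prod_congr rfl fun i _ => ?_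
  simp [Multiset.map_nsmul, Multiset.prod_nsmul]

theorem aeval_powerSum_injective [CharZero K] : Function.Injective
    (MvPolynomial.aeval (R := K) fun i => powerSum K (i + 1)) := by
  rw [injective_iff_map_eq_zero]
  intro f hf
  by_contra hne
  obtain ⟨α, hα, hmax⟩ := Finset.exists_max_image f.support
    (fun β => β.toMultiset.card) (MvPolynomial.support_nonempty.2 hne)
  obtain ⟨d, hd⟩ := exists_vals (α.toMultiset.map (· + 1)) (by simp)
  have h0 := congrArg (MvPowerSeries.coeff d) hf
  rw [f.as_sum, map_sum, map_sum, Finset.sum_eq_single_of_mem α hα] at h0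
  · rw [aeval_monomial_eq, map_smul] at h0
    obtain ⟨N, h1, h2, -⟩ := coeff_prod_powerSum (K := K) α.toMultiset d
    rw [h1] at h0
    have hN := h2 hd
    have : MvPolynomial.coeff α f ≠ 0 := MvPolynomial.mem_support_iff.1 hα
    simp [this, hN.ne'] at h0
  · intro β hβ hβα
    rw [aeval_monomial_eq, map_smul]
    obtain ⟨N, h1, -, h3⟩ := coeff_prod_powerSum (K := K) β.toMultiset d
    rcases Nat.eq_zero_or_pos N with hN | hN
    · rw [h1, hN]; simp
    · exfalso
      obtain ⟨hc, he⟩ := h3 hN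
      have hle := hmax β hβ
      have hcd : (vals d).card = α.toMultiset.card := by rw [hd]; simp
      have := he (by omega)
      rw [hd] at this
      have hab := Multiset.map_injective (add_left_injective 1) this
      apply hβα
      rw [← Finsupp.toMultiset_toFinsupp α, ← Finsupp.toMultiset_toFinsupp β, hab]

theorem exists_newton_inverse [CharZero K] : ∃ Q H : ℕ → MvPolynomial ℕ K,
    (∀ n : ℕ, ((n : K) + 1) • MvPolynomial.X n = Q n +
      ∑ r ∈ range n, Q r * MvPolynomial.X (n - r - 1)) ∧
    (∀ n : ℕ, ((n : K) + 1) • H n = MvPolynomial.X n +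
      ∑ r ∈ range n, MvPolynomial.X r * H (n - r - 1)) := by
  let Q : ℕ → MvPolynomial ℕ K := fun n => Nat.strongRec (motive := fun _ => MvPolynomial ℕ K)
    (fun (n : ℕ) ih => ((n : K) + 1) • MvPolynomial.X n - ∑ r : Fin n, ih r r.2 * MvPolynomial.X (n - r - 1)) n
  let H : ℕ → MvPolynomial ℕ K := fun n => Nat.strongRec (motive := fun _ => MvPolynomial ℕ K)
    (fun (n : ℕ) ih => ((n : K) + 1)⁻¹ • (MvPolynomial.X n + ∑ r : Fin n, MvPolynomial.X (r : ℕ) *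
      ih (n - r - 1) (by have := r.2; omega))) n
  refine ⟨Q, H, fun (n : ℕ) => ?_, fun (n : ℕ) => ?_⟩
  · have : Q n = ((n : K) + 1) • MvPolynomial.X n -
        ∑ r : Fin n, Q r * MvPolynomial.X (n - r - 1) := by
      simp only [Q]; rw [Nat.strongRec]
    rw [this, Finset.sum_range fun r => Q r * MvPolynomial.X (n - r - 1)]
    ring
  · have : H n = ((n : K) + 1)⁻¹ • (MvPolynomial.X n + ∑ r : Fin n, MvPolynomial.X (r : ℕ) *
        H (n - r - 1)) := by
      simp only [H]; rw [Nat.strongRec]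
    rw [Finset.sum_range fun r => MvPolynomial.X r * H (n - r - 1)]
    conv_lhs => rw [this]
    rw [smul_smul, mul_inv_cancel₀ (Nat.cast_add_one_ne_zero n), one_smul]

theorem aeval_completeH_injective [CharZero K] : Function.Injective
    (MvPolynomial.aeval (R := K) fun i => completeH K (i + 1)) := by
  obtain ⟨Q, H, hQ, hH⟩ := exists_newton_inverse (K := K)
  have hn : ∀ n : ℕ, ((n : K) + 1) ≠ 0 := Nat.cast_add_one_ne_zero
  have h1 : ∀ n, MvPolynomial.aeval (R := K) Q (H n) = MvPolynomial.X n := by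
    intro n
    induction n using Nat.strong_induction_on with
    | _ n ih =>
      have := congrArg (MvPolynomial.aeval (R := K) Q) (hH n)
      rw [map_smul, map_add, map_sum, MvPolynomial.aeval_X] at this
      rw [Finset.sum_congr rfl (g := fun r => Q r * MvPolynomial.X (n - r - 1)), ← hQ n] at this
      · exact smul_right_injective _ (hn n) this
      · intro r hr
        have : r < n := by simpa using hr
        rw [map_mul, MvPolynomial.aeval_X, ih _ (by omega)]
  have h2 : ∀ n, MvPolynomial.aeval (R := K) (fun i => completeH K (i + 1)) (Q n) =
      powerSum K (n + 1) := by
    intro n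
    induction n using Nat.strong_induction_on with
    | _ n ih =>
      have := congrArg (MvPolynomial.aeval (R := K) (fun i => completeH K (i + 1))) (hQ n)
      rw [map_smul, map_add, map_sum, MvPolynomial.aeval_X, newton, Finset.sum_range_succ,
        add_comm, Finset.sum_congr rfl (g := fun r => MvPolynomial.aeval (R := K)
          (fun i => completeH K (i + 1)) (Q r * MvPolynomial.X (n - r - 1)))] at this
      · have h0 : completeH K 0 = 1 := by
          ext d
          classical
          rw [coeff_completeH, MvPowerSeries.coeff_one]
          simp [Finsupp.degree_eq_zero_iff]
        rw [Nat.sub_self, h0, mul_one] at this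
        exact (add_right_cancel this).symm
      · intro r hr
        have : r < n := by simpa using hr
        rw [map_mul, MvPolynomial.aeval_X, ih r this]
        congr 2
        omega
  have h3 : ∀ f, MvPolynomial.aeval (R := K) Q (MvPolynomial.aeval (R := K) H f) = f := by
    intro f
    have : (MvPolynomial.aeval (R := K) Q).comp (MvPolynomial.aeval (R := K) H) =
        AlgHom.id K _ := MvPolynomial.algHom_ext fun i => by
      rw [AlgHom.comp_apply, MvPolynomial.aeval_X, h1, AlgHom.id_apply]
    exact DFunLike.congr_fun this f
  have h4 : ∀ f, MvPolynomial.aeval (R := K) (fun i => completeH K (i + 1))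
      (MvPolynomial.aeval (R := K) Q f) =
        MvPolynomial.aeval (R := K) (fun i => powerSum K (i + 1)) f := by
    intro f
    have : (MvPolynomial.aeval (R := K) (fun i => completeH K (i + 1))).comp
        (MvPolynomial.aeval (R := K) Q) =
          MvPolynomial.aeval (R := K) (fun i => powerSum K (i + 1)) :=
      MvPolynomial.algHom_ext fun i => by simp [h2]
    exact DFunLike.congr_fun this f
  rw [injective_iff_map_eq_zero]
  intro f hf
  rw [← h3 f, h4] at hf
  rw [← h3 f, (injective_iff_map_eq_zero _).1 aeval_powerSum_injective _ hf, map_zero]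

theorem linearIndependent_completeHPart [CharZero K] : LinearIndependent K
    (fun ν : Σ n : ℕ, n.Partition => completeHPart K ν.2) := by
  have hm : LinearIndependent K (fun ν : Σ n : ℕ, n.Partition =>
      MvPolynomial.monomial (R := K) (Multiset.toFinsupp (ν.2.parts.map Nat.pred)) 1) := by
    refine (MvPolynomial.basisMonomials ℕ K).linearIndependent.comp
      (fun ν : Σ n : ℕ, n.Partition => Multiset.toFinsupp (ν.2.parts.map Nat.pred)) ?_
    rintro ⟨m, ν⟩ ⟨n, κ⟩ h
    have hmap : ∀ {n : ℕ} (ν : n.Partition), (ν.parts.map Nat.pred).map Nat.succ = ν.parts := by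
      intro n ν
      rw [Multiset.map_map]
      conv_rhs => rw [← Multiset.map_id ν.parts]
      exact Multiset.map_congr rfl fun a ha => Nat.succ_pred_eq_of_pos (ν.parts_pos ha)
    have hp : ν.parts = κ.parts := by
      rw [← hmap ν, ← hmap κ, Multiset.toFinsupp.injective h]
    have hmn : m = n := by rw [← ν.parts_sum, ← κ.parts_sum, hp]
    subst hmn
    rw [Nat.Partition.ext hp]
  have := hm.map' (MvPolynomial.aeval (R := K) fun i => completeH K (i + 1)).toLinearMap
    (LinearMap.ker_eq_bot.2 aeval_completeH_injective)
  suffices e : (fun ν : Σ n : ℕ, n.Partition => completeHPart K ν.2) =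
      (MvPolynomial.aeval (R := K) fun i => completeH K (i + 1)).toLinearMap ∘
        fun ν : Σ n : ℕ, n.Partition =>
          MvPolynomial.monomial (R := K) (Multiset.toFinsupp (ν.2.parts.map Nat.pred)) 1 by
    rw [e]; exact this
  funext ν
  simp only [Function.comp_apply, AlgHom.toLinearMap_apply]
  rw [aeval_monomial_eq, one_smul, Multiset.toFinsupp_toMultiset, Multiset.map_map]
  unfold completeHPart
  congr 1
  refine Multiset.map_congr rfl fun a ha => ?_
  simp only [Function.comp_apply]
  rw [← Nat.succ_eq_add_one, Nat.succ_pred_eq_of_pos (ν.2.parts_pos ha)]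


theorem vals_exponent {n : ℕ} (ν : n.Partition) : vals (exponent ν) = ν.parts := by
  have hpos : ∀ a ∈ rows ν, 0 < a := fun a ha => ν.parts_pos (by
    rw [rows, Multiset.mem_sort] at ha; exact ha)
  have hsupp : (exponent ν).support = range (rows ν).length := by
    ext i
    rw [Finsupp.mem_support_iff, mem_range, exponent, List.toFinsupp_apply]
    constructor
    · intro h
      by_contra hi
      exact h (List.getD_eq_default _ _ (not_lt.1 hi))
    · intro hi
      rw [List.getD_eq_getElem _ _ hi]
      exact (hpos _ (List.getElem_mem hi)).ne'
  have hlist : (List.range (rows ν).length).map (exponent ν) = rows ν := by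
    refine List.ext_getElem (by simp) fun i h1 h2 => ?_
    rw [List.getElem_map, List.getElem_range, exponent, List.toFinsupp_apply,
      List.getD_eq_getElem _ _ h2]
  unfold vals
  rw [hsupp]
  change Multiset.map _ (↑(List.range (rows ν).length) : Multiset ℕ) = _
  rw [Multiset.map_coe, hlist]
  exact Multiset.sort_eq _ _

variable (K) in
open Classical in
/-- The monomial symmetric function `m_ν`: the sum of all monomials whose nonzero exponents are the
parts of `ν`. -/
noncomputable def monomialSym {n : ℕ} (ν : n.Partition) : MvPowerSeries ℕ K :=
  fun d => if vals d = ν.parts then 1 else 0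

open Classical in
/-- The Hall pairing `⟨f, g⟩`: the bilinear form for which the bases `(h_ν)` and `(m_ν)` are dual to
each other. Writing `f = ∑ a_ν h_ν` (the `h_ν` are linearly independent and span the symmetric
functions), `⟨f, g⟩ = ∑ a_ν b_ν`, where `b_ν` is the coefficient of `m_ν` in the symmetric function
`g`, that is, the coefficient of the monomial `x^ν` in `g`. -/
noncomputable def hallPairing [CharZero K] (f g : MvPowerSeries ℕ K) : K :=
  if hf : f ∈ Submodule.span K
      (Set.range fun ν : Σ n : ℕ, n.Partition => completeHPart K ν.2) then
    (linearIndependent_completeHPart.repr ⟨f, hf⟩).sum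
      fun ν a => a * MvPowerSeries.coeff (exponent ν.2) g
  else 0

theorem hallPairing_completeHPart [CharZero K] {n : ℕ} (ν : n.Partition)
    (g : MvPowerSeries ℕ K) :
    hallPairing (completeHPart K ν) g = MvPowerSeries.coeff (exponent ν) g := by
  have hf : completeHPart K ν ∈ Submodule.span K
      (Set.range fun ν : Σ n : ℕ, n.Partition => completeHPart K ν.2) :=
    Submodule.subset_span ⟨⟨n, ν⟩, rfl⟩
  rw [hallPairing, dif_pos hf,
    LinearIndependent.repr_eq_single linearIndependent_completeHPart ⟨n, ν⟩ ⟨_, hf⟩ rfl]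
  simp

/-- The duality of the bases `(h_ν)` and `(m_ν)`. -/
theorem hallPairing_completeHPart_monomialSym [CharZero K] {n : ℕ} (ν κ : n.Partition) :
    hallPairing (completeHPart K ν) (monomialSym K κ) = if ν = κ then 1 else 0 := by
  rw [hallPairing_completeHPart]
  change (if vals (exponent ν) = κ.parts then (1 : K) else 0) = _
  rw [vals_exponent]
  simp [Nat.Partition.ext_iff]

/-- The content of a tableau: the exponent of `i` is the number of cells with entry `i`. -/
noncomputable def content {D : YoungDiagram} (T : SemistandardYoungTableau D) : ℕ →₀ ℕ :=
  ∑ c ∈ D.cells, Finsupp.single (T c.1 c.2) 1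

/-- The Schur function `s_λ = ∑_T x^T`, over semistandard tableaux `T` of shape `λ`. -/
noncomputable def schur {n : ℕ} (lam : n.Partition) : MvPowerSeries ℕ ℚ :=
  fun d => (Nat.card {T : SemistandardYoungTableau (diagram lam) // content T = d} : ℚ)

/-- For a symmetric function `f`, the symmetric function `f(𝐱𝐲)` in `𝐱`, where `𝐱𝐲` is the set of
variables `x_i y_j` and `y_j = q^j` (`i, j ≥ 0`). The variables of `f` are indexed by pairs through
the bijection `ℕ × ℕ ≃ ℕ` (`f` being symmetric, any bijection gives the same result). The monomial
`∏ (x_i y_j)^{β(i,j)}` is `x^α q^m` with `α_i = ∑_j β(i,j)` and `m = ∑ j β(i,j)`, and for given `α`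
and `m` there are finitely many such `β`. -/
noncomputable def evalXY (f : MvPowerSeries ℕ ℚ) : MvPowerSeries ℕ (LaurentSeries ℚ) :=
  fun α => HahnSeries.ofPowerSeries ℤ ℚ <| PowerSeries.mk fun m =>
    ∑ᶠ β ∈ {β : ℕ × ℕ →₀ ℕ | β.mapDomain Prod.fst = α ∧ (β.sum fun p e => p.2 * e) = m},
      MvPowerSeries.coeff (β.equivMapDomain Nat.pairEquiv) f

end SymmetricFunctions

/-! ### The functions `𝒜_{λμ}(q)` -/

section CalA

instance : CharZero (LaurentSeries ℚ) := algebraRat.charZero _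

/-- The variable `q`, in the field `ℚ((q))` of Laurent series, which contains `ℚ(q)`. -/
noncomputable def qVar : LaurentSeries ℚ := HahnSeries.single 1 1

/-- The hook polynomial `H_λ(q) = ∏ (1 - q^{h(s)})`, over the cells `s` of `λ`. -/
noncomputable def hookPoly {n : ℕ} (lam : n.Partition) : LaurentSeries ℚ :=
  ∏ c ∈ (diagram lam).cells, (1 - qVar ^ hookLength (diagram lam) c)

/-- `𝒜_{λμ}(q) = q^{(1-g)|λ|} (q^{-n(λ)} H_λ(q))^{2g+k-2} ∏_i ⟨h_{μ^i}(𝐱_i), s_λ(𝐱_i 𝐲)⟩`. -/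
noncomputable def calA (g : ℕ) {k n : ℕ} (μ : Fin k → n.Partition) (lam : n.Partition) :
    LaurentSeries ℚ :=
  qVar ^ ((1 - (g : ℤ)) * n) *
    (qVar ^ (-(nStat lam : ℤ)) * hookPoly lam) ^ (2 * (g : ℤ) + k - 2) *
    ∏ i, hallPairing (completeHPart (LaurentSeries ℚ) (μ i)) (evalXY (schur lam))

/-- `v(λ)`, the `q`-adic valuation of `𝒜_{λμ}(q)`. -/
noncomputable def valuationA (g : ℕ) {k n : ℕ} (μ : Fin k → n.Partition) (lam : n.Partition) : ℤ :=
  (calA g μ lam).order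

/-- `δ(μ) = (2g-2+k) n - ∑_i μ^i_1`. -/
def smallDelta (g : ℕ) {k n : ℕ} (μ : Fin k → n.Partition) : ℤ :=
  (2 * (g : ℤ) - 2 + k) * n - ∑ i, (part (μ i) 0 : ℤ)

/-- `Δ(μ) = ½ (2g-2+k) n² - ½ ∑_{i,j} (μ^i_j)²`. -/
def bigDelta (g : ℕ) {k n : ℕ} (μ : Fin k → n.Partition) : ℚ :=
  (1 / 2) * (2 * (g : ℚ) - 2 + k) * n ^ 2 -
    (1 / 2) * ∑ i, ∑ j ∈ Finset.range (rows (μ i)).length, (part (μ i) j : ℚ) ^ 2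

end CalA

end SymFun

/-! ### Quivers, roots, affine type -/

/-- A finite quiver with vertex set `I`. -/
structure FinQuiver (I : Type) where
  /-- The set of arrows. -/
  Arrow : Type
  /-- There are finitely many arrows. -/
  fintypeArrow : Fintype Arrow
  /-- The head of an arrow. -/
  head : Arrow → I
  /-- The tail of an arrow. -/
  tail : Arrow → I

namespace FinQuiver

variable {I : Type} [Fintype I] [DecidableEq I] (Q : FinQuiver I)

/-- The number of arrows joining `i` and `j`, in either direction. -/
noncomputable def numEdges (i j : I) : ℕ :=
  Nat.card {a : Q.Arrow // (Q.tail a = i ∧ Q.head a = j) ∨ (Q.tail a = j ∧ Q.head a = i)}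

/-- The Cartan matrix of a quiver. -/
noncomputable def cartan : Matrix I I ℤ :=
  fun i j => if i = j then 2 - 2 * (Q.numEdges i i : ℤ) else -(Q.numEdges i j : ℤ)

/-- The underlying simple graph: distinct vertices are adjacent if some arrow joins them. -/
def graph : SimpleGraph I := SimpleGraph.fromRel fun i j => ∃ a, Q.tail a = i ∧ Q.head a = j

/-- The (doubled) Tits form `ᵗx C x`. -/
noncomputable def titsForm (x : I → ℤ) : ℤ := x ⬝ᵥ Q.cartan.mulVec x

/-- The quiver is of affine type: it is connected and its Tits form is positive semidefinite, but
not positive definite. -/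
def IsAffine : Prop :=
  Q.graph.Connected ∧ (∀ x, 0 ≤ Q.titsForm x) ∧ ∃ x, x ≠ 0 ∧ Q.titsForm x = 0

/-- The fundamental set of imaginary roots: nonzero dimension vectors with connected support that
pair nonpositively, in the Cartan pairing, with every coordinate vector. -/
def IsFundamental (u : I → ℤ) : Prop :=
  (∀ i, 0 ≤ u i) ∧ u ≠ 0 ∧ (Q.graph.induce {i | u i ≠ 0}).Connected ∧
    ∀ i, Q.cartan.mulVec u i ≤ 0

/-- The fundamental reflection at a vertex `i`. -/
noncomputable def reflect (i : I) (u : I → ℤ) : I → ℤ := u - Pi.single i (Q.cartan.mulVec u i)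

/-- The positive imaginary roots: the images of the fundamental set under the Weyl group, which is
generated by the reflections at the vertices without loops. -/
inductive IsPosImaginaryRoot : (I → ℤ) → Prop
  | fundamental (u : I → ℤ) (hu : Q.IsFundamental u) : IsPosImaginaryRoot u
  | reflection (i : I) (hi : Q.numEdges i i = 0) (u : I → ℤ) (hu : IsPosImaginaryRoot u) :
      IsPosImaginaryRoot (Q.reflect i u)

/-- `u` is the basic positive imaginary root: the positive imaginary roots are the multiples `t u`,
`t ≥ 1`. -/
def IsBasicImaginaryRoot (u : I → ℤ) : Prop :=
  ∀ w : I → ℤ, Q.IsPosImaginaryRoot w ↔ ∃ t : ℕ, 1 ≤ t ∧ w = t • u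

end FinQuiver

namespace SymFun

/-- The legs of the quiver of `μ`: the pair `⟨i, j⟩` stands for the vertex `[i, j + 1]`, and the
`i`-th leg has length `l(μ^i) - 1`. -/
abbrev Leg {k n : ℕ} (μ : Fin k → n.Partition) : Type :=
  Σ i : Fin k, Fin ((rows (μ i)).length - 1)

/-- The vertices of the quiver of `μ`: the central vertex `none` and the vertices on the legs. -/
abbrev CometVertex {k n : ℕ} (μ : Fin k → n.Partition) : Type := Option (Leg μ)

/-- The comet-shaped quiver of `μ`: `g` loops at the central vertex, and an arrow from every vertex
on a leg to the preceding one (the central vertex precedes the first vertex of each leg). -/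
def cometQuiver (g : ℕ) {k n : ℕ} (μ : Fin k → n.Partition) : FinQuiver (CometVertex μ) where
  Arrow := Fin g ⊕ Leg μ
  fintypeArrow := inferInstance
  tail
    | Sum.inl _ => none
    | Sum.inr p => some p
  head
    | Sum.inl _ => none
    | Sum.inr ⟨_, ⟨0, _⟩⟩ => none
    | Sum.inr ⟨i, ⟨j + 1, hj⟩⟩ => some ⟨i, ⟨j, Nat.lt_of_succ_lt hj⟩⟩

/-- The dimension vector of `μ`: `v_0 = n` and `v_{[i,j]} = n - (μ^i_1 + ⋯ + μ^i_j)`. -/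
def dimVector {k n : ℕ} (μ : Fin k → n.Partition) : CometVertex μ → ℤ
  | none => n
  | some ⟨i, j⟩ => n - ∑ r ∈ Finset.range ((j : ℕ) + 1), (part (μ i) r : ℤ)

end SymFun

namespace SymFun

open Finset

/-! ### Young diagrams and their columns -/

/-! Write `N(λ) = 2 n(λ) + n`, which is the sum of the squares of the column lengths of `λ`. Pairing
with `h_μ` extracts the coefficient of `x^μ` in `s_λ(𝐱𝐲)`, a power series in `q` whose coefficients
count tableaux. Nothing cancels, so it is nonzero and its order is the least degree `m_i` of a
monomial that occurs (`order_hallPairing`). Hook polynomials have constant term 1, hence `2 v(λ) = ∑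
(2 m_i + n) - (2g-2+k) N(λ)`. For `λ = (1^n)` one has `N = n²` and `2 m_i + n = ∑_p (μ^i_p)²`, which
gives `-Δ(μ)`. Since `(2g-2+k) n = δ + ∑ μ^i_1`, the difference `2n (v(λ) - v((1^n)))` splits as `δ
(n² - N(λ)) + ∑_i gap_i` (`valuationA_sub`), and everything rests on `gap_i ≥ 0`
(`gap_nonneg_and_eq_zero`).

For one `μ`, a monomial of the pairing is a matrix `β(p, j)` with row sums `μ_p`. Let `x_{ps}` be
the number of `j` with `β(p, j) > s`. Three inequalities combine. The `j` counted by `x_{ps}` are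
distinct, so `2m + n ≥ ∑ x_{ps}²`. A tableau of shape `λ` with content `β` forces the sums `c_s =
∑_p x_{ps}` to dominate the columns of `λ`, so `∑ c_s² ≥ N(λ)`. Finally `μ_1 n² - n ∑ μ_p² + n ∑
x_{ps}² - μ_1 ∑ c_s²` is a sum of nonnegative terms (`quadratic_identity`).

Equality with `λ ≠ (1^n)` forces `δ = 0`, all parts of each `μ^i` equal, and every column length of
`λ` divisible by each `l(μ^i)`, hence by their least common multiple `L`. Multiplicities of parts
are differences of columns, so `λ` is a union of `L` copies of a partition. Conversely, such unions
attain equality by an explicit tableau (`keyTableau`).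

On the quiver side, `C 𝐯` has entry `-δ` at the centre and differences of consecutive parts on the
legs, so `𝐯` is in the radical exactly when `δ = 0` and all `μ^i` are rectangular. Radical vectors
are linear along the legs and vanish just past their ends. In the rectangular case with `δ = 0` they
are therefore the multiples of one positive vector with central value `L`. A positive radical vector
makes the Tits form semidefinite, and then the imaginary roots are the positive multiples of that
vector, so `t = n / L`. -/

theorem sum_cells_filter_snd_lt (D : YoungDiagram) (r : ℕ) (f : ℕ × ℕ → ℕ) :
    ∑ c ∈ D.cells with c.2 < r, f c = ∑ s ∈ range r, ∑ i ∈ range (D.colLen s), f (i, s) := by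
  rw [Finset.sum_sigma']
  refine Finset.sum_bij' (fun c _ => (⟨c.2, c.1⟩ : Σ _ : ℕ, ℕ)) (fun c _ => (c.2, c.1))
    ?_ ?_ ?_ ?_ ?_
  · rintro ⟨i, j⟩ hc
    simp only [mem_filter, YoungDiagram.mem_cells] at hc
    simp only [mem_sigma, mem_range]
    exact ⟨hc.2, YoungDiagram.mem_iff_lt_colLen.1 hc.1⟩
  · rintro ⟨j, i⟩ hc
    simp only [mem_sigma, mem_range] at hc
    simp only [mem_filter, YoungDiagram.mem_cells]
    exact ⟨YoungDiagram.mem_iff_lt_colLen.2 hc.2, hc.1⟩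
  · intros; rfl
  · intros; rfl
  · intros; rfl

theorem rowLen_le_card (D : YoungDiagram) (i : ℕ) : D.rowLen i ≤ D.cells.card := by
  rw [YoungDiagram.rowLen_eq_card]
  exact Finset.card_le_card (Finset.filter_subset _ _)

theorem snd_lt_card {D : YoungDiagram} {c : ℕ × ℕ} (hc : c ∈ D.cells) : c.2 < D.cells.card :=
  (YoungDiagram.mem_iff_lt_rowLen.1 ((YoungDiagram.mem_cells c).1 hc)).trans_le (rowLen_le_card D _)

/-- A diagram has no more columns than cells, so any `r` above the number of cells is a valid
cutoff. All column sums can then run over `range n`. -/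
theorem sum_cells_eq (D : YoungDiagram) {r : ℕ} (hr : D.cells.card ≤ r) (f : ℕ × ℕ → ℕ) :
    ∑ c ∈ D.cells, f c = ∑ s ∈ range r, ∑ i ∈ range (D.colLen s), f (i, s) := by
  rw [← sum_cells_filter_snd_lt, Finset.filter_true_of_mem]
  exact fun c hc => (snd_lt_card hc).trans_le hr

theorem card_filter_snd_lt (D : YoungDiagram) (r : ℕ) :
    #{c ∈ D.cells | c.2 < r} = ∑ s ∈ range r, D.colLen s := by
  rw [Finset.card_eq_sum_ones, sum_cells_filter_snd_lt]
  simp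

theorem sum_colLen (D : YoungDiagram) {r : ℕ} (hr : D.cells.card ≤ r) :
    ∑ s ∈ range r, D.colLen s = D.cells.card := by
  rw [Finset.card_eq_sum_ones, sum_cells_eq D hr]
  simp

theorem two_mul_sum_range_add (a : ℕ) : 2 * ∑ i ∈ range a, i + a = a ^ 2 := by
  have := Finset.sum_range_id_mul_two a
  rcases a with _ | a
  · simp
  · simp only [Nat.add_sub_cancel] at this
    nlinarith

/-- `2 n(λ) + |λ|` is the sum of the squares of the column lengths. -/
theorem two_mul_sum_fst_add_card (D : YoungDiagram) {r : ℕ} (hr : D.cells.card ≤ r) :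
    2 * ∑ c ∈ D.cells, c.1 + D.cells.card = ∑ s ∈ range r, D.colLen s ^ 2 := by
  rw [sum_cells_eq D hr, ← sum_colLen D hr, Finset.mul_sum, ← Finset.sum_add_distrib]
  exact Finset.sum_congr rfl fun s _ => two_mul_sum_range_add _

/-! ### The diagram of a partition -/

variable {n : ℕ}

theorem coe_rows (lam : n.Partition) : (rows lam : Multiset ℕ) = lam.parts :=
  Multiset.sort_eq _ _

theorem rows_pos (lam : n.Partition) {a : ℕ} (ha : a ∈ rows lam) : 0 < a :=
  lam.parts_pos (by rwa [rows, Multiset.mem_sort] at ha)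

theorem part_of_lt (lam : n.Partition) {i : ℕ} (hi : i < (rows lam).length) :
    part lam i = (rows lam)[i] := List.getD_eq_getElem _ _ hi

theorem part_of_le (lam : n.Partition) {i : ℕ} (hi : (rows lam).length ≤ i) : part lam i = 0 :=
  List.getD_eq_default _ _ hi

theorem part_pos_iff (lam : n.Partition) {i : ℕ} : 0 < part lam i ↔ i < (rows lam).length := by
  constructor
  · intro h
    by_contra hi
    rw [part_of_le lam (not_lt.1 hi)] at h
    exact lt_irrefl _ h
  · intro h
    rw [part_of_lt lam h]
    exact rows_pos lam (List.getElem_mem h)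

theorem mem_diagram (lam : n.Partition) {i j : ℕ} : (i, j) ∈ diagram lam ↔ j < part lam i := by
  rw [diagram, YoungDiagram.mem_ofRowLens]
  constructor
  · rintro ⟨h, h'⟩
    rw [part_of_lt lam h]; exact h'
  · intro h
    have hi := (part_pos_iff lam).1 (Nat.zero_lt_of_lt h)
    exact ⟨hi, by rwa [part_of_lt lam hi] at h⟩

theorem rowLen_diagram (lam : n.Partition) (i : ℕ) : (diagram lam).rowLen i = part lam i :=
  eq_of_forall_lt_iff fun j => by rw [← YoungDiagram.mem_iff_lt_rowLen, mem_diagram]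

theorem part_anti (lam : n.Partition) : Antitone (part lam) := fun i j h => by
  rw [← rowLen_diagram, ← rowLen_diagram]
  exact YoungDiagram.rowLen_anti _ _ _ h

theorem sum_cells_diagram (lam : n.Partition) (f : ℕ × ℕ → ℕ) :
    ∑ c ∈ (diagram lam).cells, f c =
      ∑ i ∈ range (rows lam).length, ∑ j ∈ range (part lam i), f (i, j) := by
  rw [Finset.sum_sigma']
  refine Finset.sum_bij' (fun c _ => (⟨c.1, c.2⟩ : Σ _ : ℕ, ℕ)) (fun c _ => (c.1, c.2))
    ?_ ?_ ?_ ?_ ?_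
  · rintro ⟨i, j⟩ hc
    rw [YoungDiagram.mem_cells, mem_diagram] at hc
    simp only [mem_sigma, mem_range]
    exact ⟨(part_pos_iff lam).1 (Nat.zero_lt_of_lt hc), hc⟩
  · rintro ⟨i, j⟩ hc
    simp only [mem_sigma, mem_range] at hc
    rw [YoungDiagram.mem_cells, mem_diagram]
    exact hc.2
  · intros; rfl
  · intros; rfl
  · intros; rfl

/-- Passes between sums by position and sums over the multiset of parts. The range is the exact
length, so `f 0` need not vanish. -/
theorem sum_map_parts {M : Type*} [AddCommMonoid M] (lam : n.Partition) (f : ℕ → M) :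
    ∑ i ∈ range (rows lam).length, f (part lam i) = (lam.parts.map f).sum := by
  rw [← coe_rows, Multiset.map_coe, Multiset.sum_coe, Finset.sum_range, ← Fin.sum_univ_getElem]
  rw [← Fin.sum_congr' _ (List.length_map (as := rows lam) f)]
  refine Finset.sum_congr rfl fun i _ => ?_
  have hi : (i : ℕ) < (rows lam).length := by simpa using i.2
  simp [part_of_lt lam hi]

theorem sum_part (lam : n.Partition) : ∑ i ∈ range (rows lam).length, part lam i = n := by
  have := sum_map_parts lam id
  simpa [lam.parts_sum] using this

theorem card_diagram (lam : n.Partition) : (diagram lam).cells.card = n := by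
  rw [Finset.card_eq_sum_ones, sum_cells_diagram]
  simp [sum_part]

theorem sum_fst_diagram (lam : n.Partition) : ∑ c ∈ (diagram lam).cells, c.1 = nStat lam := by
  rw [sum_cells_diagram, nStat]
  simp [mul_comm]

theorem card_filter_lt_part (lam : n.Partition) (s : ℕ) :
    #{i ∈ range (rows lam).length | s < part lam i} = lam.parts.countP (s < ·) := by
  rw [Finset.card_filter, sum_map_parts lam (fun a => if s < a then 1 else 0)]
  induction lam.parts using Multiset.induction with
  | empty => simp
  | cons a t ih => rw [Multiset.map_cons, Multiset.sum_cons, ih, Multiset.countP_cons, add_comm]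

/-- In this form the column lengths depend on the multiset of parts alone and are additive under
unions of partitions. -/
theorem colLen_diagram (lam : n.Partition) (s : ℕ) :
    (diagram lam).colLen s = lam.parts.countP (s < ·) := by
  rw [← card_filter_lt_part, ← Finset.card_range ((diagram lam).colLen s)]
  congr 1
  ext i
  rw [mem_range, mem_filter, mem_range, ← YoungDiagram.mem_iff_lt_colLen, mem_diagram,
    ← part_pos_iff]
  exact ⟨fun h => ⟨Nat.zero_lt_of_lt h, h⟩, fun h => h.2⟩

theorem two_mul_nStat_add (lam : n.Partition) :
    2 * nStat lam + n = ∑ s ∈ range n, (diagram lam).colLen s ^ 2 := by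
  have := two_mul_sum_fst_add_card (diagram lam) (card_diagram lam).le
  rwa [sum_fst_diagram, card_diagram] at this

theorem sum_colLen_diagram (lam : n.Partition) :
    ∑ s ∈ range n, (diagram lam).colLen s = n := by
  rw [sum_colLen _ (card_diagram lam).le, card_diagram]

/-- Multiplicities are differences of consecutive columns, so a common divisor of the columns
divides every multiplicity. -/
theorem count_parts (lam : n.Partition) (r : ℕ) :
    lam.parts.count (r + 1) + (diagram lam).colLen (r + 1) = (diagram lam).colLen r := by
  rw [colLen_diagram, colLen_diagram]
  induction lam.parts using Multiset.induction with
  | empty => simp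
  | cons a t ih =>
    rw [Multiset.count_cons, Multiset.countP_cons, Multiset.countP_cons, ← ih]
    split_ifs <;> omega

theorem parts_ones (n : ℕ) : (ones n).parts = Multiset.replicate n 1 := by
  rw [ones, Nat.Partition.ofSums_parts, Multiset.filter_eq_self]
  intro a ha
  rw [Multiset.eq_of_mem_replicate ha]
  exact one_ne_zero

theorem colLen_ones (n s : ℕ) : (diagram (ones n)).colLen s = if s = 0 then n else 0 := by
  rw [colLen_diagram, parts_ones]
  split_ifs with h
  · rw [Multiset.countP_eq_card.2, Multiset.card_replicate]
    intro a ha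
    rw [Multiset.eq_of_mem_replicate ha]; omega
  · rw [Multiset.countP_eq_zero]
    intro a ha
    rw [Multiset.eq_of_mem_replicate ha]; omega

theorem two_mul_nStat_ones_add (n : ℕ) : 2 * nStat (ones n) + n = n ^ 2 := by
  rw [two_mul_nStat_add]
  simp only [colLen_ones]
  rcases n with _ | n
  · simp
  · rw [Finset.sum_eq_single_of_mem 0 (by simp)]
    · simp
    · intro s _ hs; simp [hs]

/-- No column exceeds the first, so the sum of squares is at most `n` times the number of parts.
Reaching `n²` needs `n` parts, each then equal to 1. -/
theorem eq_ones_of_nStat (lam : n.Partition) (h : 2 * nStat lam + n = n ^ 2) : lam = ones n := by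
  rcases Nat.eq_zero_or_pos n with rfl | hn
  · exact Subsingleton.elim _ _
  have h1 : ∑ s ∈ range n, (diagram lam).colLen s ^ 2 ≤ (diagram lam).colLen 0 * n := by
    refine le_of_le_of_eq ?_ (congrArg ((diagram lam).colLen 0 * ·) (sum_colLen_diagram lam))
    rw [Finset.mul_sum]
    refine Finset.sum_le_sum fun s _ => ?_
    rw [sq]
    exact Nat.mul_le_mul_right _ (YoungDiagram.colLen_anti _ _ _ (Nat.zero_le _))
  rw [← two_mul_nStat_add, h, sq] at h1
  have h2 : n ≤ lam.parts.countP (0 < ·) := by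
    rw [← colLen_diagram]
    exact Nat.le_of_mul_le_mul_right h1 hn
  have h3 : n ≤ lam.parts.card := h2.trans (Multiset.countP_le_card _ _)
  have h4 : lam.parts.card • 1 ≤ lam.parts.sum :=
    Multiset.card_nsmul_le_sum fun a ha => lam.parts_pos ha
  have h5 := lam.parts_sum
  ext1
  rw [parts_ones]
  have hc : lam.parts.card = n := by simp at h4; omega
  rw [Multiset.eq_replicate]
  refine ⟨hc, fun b hb => ?_⟩
  obtain ⟨t, ht⟩ := Multiset.exists_cons_of_mem hb
  have hb0 := lam.parts_pos hb
  have h6 : t.card • 1 ≤ t.sum := Multiset.card_nsmul_le_sum fun a ha =>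
    lam.parts_pos (by rw [ht]; exact Multiset.mem_cons_of_mem ha)
  rw [ht, Multiset.card_cons] at hc
  rw [ht, Multiset.sum_cons] at h5
  simp at h6
  omega

theorem exponent_apply (ν : n.Partition) (p : ℕ) : exponent ν p = part ν p := by
  rw [exponent, List.toFinsupp_apply]; rfl

theorem support_exponent (ν : n.Partition) : (exponent ν).support = range (rows ν).length := by
  ext p
  rw [Finsupp.mem_support_iff, exponent_apply, mem_range, ← part_pos_iff, Nat.pos_iff_ne_zero]

/-! ### Column counts of exponent vectors -/

section colCount

variable {ι κ : Type*}

/-- The number of indices at which `d` exceeds `s`. -/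
def colCount (d : ι →₀ ℕ) (s : ℕ) : ℕ := #{v ∈ d.support | s < d v}

/-- Double counting of the pairs `(s, v)` with `s < d v`: the index `v` lies in `min (d v) r` of the
first `r` layers. -/
theorem sum_colCount_weighted (d : ι →₀ ℕ) (r : ℕ) (w : ι → ℕ) :
    ∑ s ∈ range r, ∑ v ∈ d.support with s < d v, w v = ∑ v ∈ d.support, min (d v) r * w v := by
  simp_rw [Finset.sum_filter]
  rw [Finset.sum_comm]
  refine Finset.sum_congr rfl fun v _ => ?_
  rw [← Finset.sum_filter, Finset.sum_const, smul_eq_mul]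
  congr 1
  have : {s ∈ range r | s < d v} = range (min (d v) r) := by
    ext s; simp only [mem_filter, mem_range, lt_min_iff]; tauto
  rw [this, card_range]

theorem sum_colCount_min (d : ι →₀ ℕ) (r : ℕ) :
    ∑ s ∈ range r, colCount d s = ∑ v ∈ d.support, min (d v) r := by
  have := sum_colCount_weighted d r (fun _ => 1)
  simpa [colCount] using this

theorem sum_colCount (d : ι →₀ ℕ) {r : ℕ} (hr : d.degree ≤ r) :
    ∑ s ∈ range r, colCount d s = d.degree := by
  rw [sum_colCount_min, Finsupp.degree]
  exact Finset.sum_congr rfl fun v _ => min_eq_left ((Finsupp.le_degree v d).trans hr)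

theorem colCount_equivMapDomain (e : ι ≃ κ) (d : ι →₀ ℕ) (s : ℕ) :
    colCount (d.equivMapDomain e) s = colCount d s := by
  classical
  refine (Finset.card_bij (fun v _ => e v) ?_ ?_ ?_).symm
  · intro v hv
    rw [mem_filter, Finsupp.mem_support_iff] at hv ⊢
    simpa only [Finsupp.equivMapDomain_apply, Equiv.symm_apply_apply] using hv
  · intro v _ w _ h
    exact e.injective h
  · intro w hw
    rw [mem_filter, Finsupp.mem_support_iff, Finsupp.equivMapDomain_apply] at hw
    exact ⟨e.symm w, by rwa [mem_filter, Finsupp.mem_support_iff], by simp⟩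

theorem sum_range_card_le_sum (S : Finset ℕ) : ∑ i ∈ range #S, i ≤ ∑ j ∈ S, j := by
  induction S using Finset.induction_on_max with
  | empty => simp
  | insert a S ha ih =>
    have hn : a ∉ S := fun h => lt_irrefl _ (ha a h)
    rw [Finset.card_insert_of_notMem hn, Finset.sum_range_succ, Finset.sum_insert hn, add_comm]
    have : #S ≤ a := by
      rw [← Finset.card_range a]
      exact Finset.card_le_card fun x hx => mem_range.2 (ha x hx)
    omega

/-- The indices in layer `s` are distinct, so with `c` of them their sum is at least `0 + ⋯ + (c -
1)`. Twice that plus `c` is `c²`. -/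
theorem sum_colCount_sq_le (d : ℕ →₀ ℕ) {r : ℕ} (hr : d.degree ≤ r) :
    ∑ s ∈ range r, colCount d s ^ 2 ≤ 2 * (d.sum fun j e => j * e) + d.degree := by
  have h : (d.sum fun j e => j * e) = ∑ s ∈ range r, ∑ v ∈ d.support with s < d v, v := by
    rw [sum_colCount_weighted d r (fun v => v), Finsupp.sum]
    refine Finset.sum_congr rfl fun v _ => ?_
    rw [min_eq_left ((Finsupp.le_degree v d).trans hr), mul_comm]
  rw [h, ← sum_colCount d hr, Finset.mul_sum, ← Finset.sum_add_distrib]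
  refine Finset.sum_le_sum fun s _ => ?_
  rw [← two_mul_sum_range_add]
  have := sum_range_card_le_sum {v ∈ d.support | s < d v}
  unfold colCount
  omega

/-- Treats `β` as a matrix and sums row by row. The finite set `P` may be any set of rows that
covers the support. -/
theorem sum_eq_sum_curry (β : ℕ × ℕ →₀ ℕ) {P : Finset ℕ} (hP : ∀ v ∈ β.support, v.1 ∈ P)
    (f : ℕ → ℕ → ℕ → ℕ) :
    ∑ v ∈ β.support, f v.1 v.2 (β v) =
      ∑ p ∈ P, ∑ j ∈ (β.curry p).support, f p j (β.curry p j) := by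
  rw [Finset.sum_sigma']
  refine Finset.sum_bij' (fun c _ => (⟨c.1, c.2⟩ : Σ _ : ℕ, ℕ)) (fun c _ => (c.1, c.2))
    ?_ ?_ ?_ ?_ ?_
  · rintro ⟨p, j⟩ hc
    simp only [mem_sigma]
    exact ⟨hP _ hc, by simpa [Finsupp.curry_apply] using hc⟩
  · rintro ⟨p, j⟩ hc
    simp only [mem_sigma] at hc
    simpa [Finsupp.curry_apply] using hc.2
  · intros; rfl
  · intros; rfl
  · intros; simp [Finsupp.curry_apply]

theorem colCount_eq_sum_curry (β : ℕ × ℕ →₀ ℕ) {P : Finset ℕ} (hP : ∀ v ∈ β.support, v.1 ∈ P)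
    (s : ℕ) : colCount β s = ∑ p ∈ P, colCount (β.curry p) s := by
  have := sum_eq_sum_curry β hP (fun _ _ e => if s < e then 1 else 0)
  simp_rw [colCount, Finset.card_filter]
  exact this

theorem mapDomain_fst_apply (β : ℕ × ℕ →₀ ℕ) (p : ℕ) :
    β.mapDomain Prod.fst p = (β.curry p).degree := by
  classical
  rw [Finsupp.mapDomain, Finsupp.sum_apply, Finsupp.sum,
    sum_eq_sum_curry β (P := β.support.image Prod.fst ∪ {p})
      (fun v hv => mem_union_left _ (mem_image_of_mem _ hv)) (fun i _ e => Finsupp.single i e p),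
    Finset.sum_eq_single_of_mem p (mem_union_right _ (mem_singleton_self p))]
  · simp_rw [Finsupp.single_eq_same]
    rfl
  · intro q _ hq
    simp [Finsupp.single_eq_of_ne hq.symm]

theorem fst_mem_support_of_mapDomain {β : ℕ × ℕ →₀ ℕ} {a : ℕ →₀ ℕ}
    (h : β.mapDomain Prod.fst = a) {v : ℕ × ℕ} (hv : v ∈ β.support) : v.1 ∈ a.support := by
  rw [← h, Finsupp.mem_support_iff, mapDomain_fst_apply]
  have h1 := Finsupp.le_degree v.2 (β.curry v.1)
  rw [Finsupp.curry_apply] at h1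
  have h2 : β v ≠ 0 := Finsupp.mem_support_iff.1 hv
  have h3 : β (v.1, v.2) = β v := rfl
  omega

end colCount

/-! ### Contents of semistandard tableaux -/

theorem content_apply {D : YoungDiagram} (T : SemistandardYoungTableau D) (v : ℕ) :
    content T v = #{c ∈ D.cells | T c.1 c.2 = v} := by
  rw [content, Finsupp.finsetSum_apply, Finset.card_filter]
  refine Finset.sum_congr rfl fun c _ => ?_
  rw [Finsupp.single_apply]

theorem entry_mem_support_content {D : YoungDiagram} (T : SemistandardYoungTableau D) {c : ℕ × ℕ}
    (hc : c ∈ D.cells) : T c.1 c.2 ∈ (content T).support := by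
  rw [Finsupp.mem_support_iff, content_apply, Finset.card_ne_zero]
  exact ⟨c, mem_filter.2 ⟨hc, rfl⟩⟩

/-- The columns of the shape are dominated by the columns of the content. -/
theorem sum_colLen_le_sum_colCount {D : YoungDiagram} (T : SemistandardYoungTableau D) (r : ℕ) :
    ∑ s ∈ range r, D.colLen s ≤ ∑ s ∈ range r, colCount (content T) s := by
  rw [sum_colCount_min, ← card_filter_snd_lt,
    Finset.card_eq_sum_card_fiberwise (f := fun c => T c.1 c.2) (t := (content T).support)]
  -- An entry `v` occurs `content T v` times in all, and at most once in each of the first `r`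
  -- columns by strictness.
  · refine Finset.sum_le_sum fun v _ => le_min ?_ ?_
    · rw [content_apply]
      exact Finset.card_le_card (Finset.filter_subset_filter _ (Finset.filter_subset _ _))
    · rw [← Finset.card_range r]
      refine Finset.card_le_card_of_injOn Prod.snd ?_ ?_
      · intro c hc
        simp only [coe_filter, mem_filter, Set.mem_ofPred_eq] at hc
        simpa using hc.1.2
      · rintro ⟨i, j⟩ hc ⟨i', j'⟩ hc' (rfl : j = j')
        simp only [coe_filter, mem_filter, Set.mem_ofPred_eq, YoungDiagram.mem_cells] at hc hc'
        rcases lt_trichotomy i i' with h | h | h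
        · have := T.col_strict h hc'.1.1; omega
        · rw [h]
        · have := T.col_strict h hc.1.1; omega
  · intro c hc
    exact entry_mem_support_content T (mem_filter.1 hc).1

theorem degree_content {D : YoungDiagram} (T : SemistandardYoungTableau D) :
    (content T).degree = D.cells.card := by
  rw [content, map_sum]
  simp

/-- If the partial sums of `c` dominate those of a decreasing sequence `u`, and the totals agree,
then `c` has the larger sum of squares. -/
theorem sum_sq_add_le_of_dominates {r : ℕ} {u c : ℕ → ℚ}
    (hu : ∀ s, u (s + 1) ≤ u s)
    (hdom : ∀ k ≤ r, ∑ s ∈ range k, u s ≤ ∑ s ∈ range k, c s)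
    (htot : ∑ s ∈ range r, u s = ∑ s ∈ range r, c s) :
    ∑ s ∈ range r, u s ^ 2 + ∑ s ∈ range r, (c s - u s) ^ 2 ≤ ∑ s ∈ range r, c s ^ 2 := by
  -- Abel summation: the partial sums of `c - u` are nonnegative and `u` decreases. At `k = r` the
  -- left side vanishes, since the totals agree.
  have key : ∀ k ≤ r, u k * ∑ s ∈ range k, (c s - u s) ≤ ∑ s ∈ range k, u s * (c s - u s) := by
    intro k
    induction k with
    | zero => simp
    | succ k ih =>
      intro hk
      rw [Finset.sum_range_succ (fun s => u s * (c s - u s))]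
      have h1 := ih (by omega)
      have h2 := hdom (k + 1) hk
      have h3 : 0 ≤ ∑ s ∈ range (k + 1), (c s - u s) := by
        rw [Finset.sum_sub_distrib]; linarith
      have h4 := mul_le_mul_of_nonneg_right (hu k) h3
      have h5 : u k * ∑ s ∈ range (k + 1), (c s - u s) =
        u k * ∑ s ∈ range k, (c s - u s) + u k * (c k - u k) := by
        rw [Finset.sum_range_succ]; ring
      linarith
  have h := key r le_rfl
  rw [Finset.sum_sub_distrib, htot, sub_self, mul_zero] at h
  have : ∑ s ∈ range r, c s ^ 2 = ∑ s ∈ range r, u s ^ 2 + ∑ s ∈ range r, (c s - u s) ^ 2 +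
      2 * ∑ s ∈ range r, u s * (c s - u s) := by
    rw [Finset.mul_sum, ← Finset.sum_add_distrib, ← Finset.sum_add_distrib]
    exact Finset.sum_congr rfl fun s _ => by ring
  linarith

/-- The squared distance is kept on the left so that equality of the sums of squares identifies the
columns themselves. -/
theorem sum_colLen_sq_add_le {D : YoungDiagram} (T : SemistandardYoungTableau D) {n : ℕ}
    (hn : D.cells.card = n) :
    ∑ s ∈ range n, (D.colLen s : ℚ) ^ 2 +
      ∑ s ∈ range n, ((colCount (content T) s : ℚ) - D.colLen s) ^ 2 ≤
        ∑ s ∈ range n, (colCount (content T) s : ℚ) ^ 2 := by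
  refine sum_sq_add_le_of_dominates ?_ ?_ ?_
  · intro s
    exact_mod_cast YoungDiagram.colLen_anti _ _ _ (Nat.le_succ s)
  · intro k _
    exact_mod_cast sum_colLen_le_sum_colCount T k
  · have h1 := sum_colLen D hn.le
    have h2 := sum_colCount (content T) ((degree_content T).trans hn).le
    rw [degree_content] at h2
    exact_mod_cast h1.trans h2.symm

/-! ### Construction of tableaux -/

theorem finite_setOf_lt (d : ℕ →₀ ℕ) (s : ℕ) : {v | s < d v}.Finite :=
  d.support.finite_toSet.subset fun v (hv : s < d v) => by
    simp only [mem_coe, Finsupp.mem_support_iff]; omega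

theorem card_setOf_lt (d : ℕ →₀ ℕ) (s : ℕ) (hf : {v | s < d v}.Finite) :
    #hf.toFinset = colCount d s := by
  unfold colCount
  congr 1
  ext v
  rw [Set.Finite.mem_toFinset, mem_filter, Finsupp.mem_support_iff]
  exact ⟨fun h => ⟨by have : s < d v := h; omega, h⟩, fun h => h.2⟩

/-- The key tableau of content `d`: column `s` consists of the indices `v` with `s < d v`. -/
noncomputable def keyTableau (D : YoungDiagram) (d : ℕ →₀ ℕ) (h : ∀ s, D.colLen s = colCount d s) :
    SemistandardYoungTableau D where
  entry i j := open Classical in if (i, j) ∈ D then Nat.nth (fun v => j < d v) i else 0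
  row_weak' := by
    classical
    intro i j₁ j₂ hj hm
    have hm1 : (i, j₁) ∈ D := D.up_left_mem le_rfl hj.le hm
    rw [if_pos hm1, if_pos hm, ← Nat.lt_succ_iff]
    apply Nat.nth_lt_of_lt_count
    have h2 := Nat.count_nth_succ (p := fun v => j₂ < d v) (n := i) fun hf => by
      rw [card_setOf_lt, ← h]; exact YoungDiagram.mem_iff_lt_colLen.1 hm
    -- The indices of column `j₂` are among those of column `j₁`, so at least `i + 1` indices of
    -- column `j₁` have appeared by the `i`-th one of column `j₂`.
    refine lt_of_lt_of_le (Nat.lt_succ_self i) (le_of_eq_of_le h2.symm ?_)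
    exact Nat.count_mono_left fun k _ hk => hj.trans hk
  col_strict' := by
    classical
    intro i₁ i₂ j hi hm
    have hm1 : (i₁, j) ∈ D := D.up_left_mem hi.le le_rfl hm
    rw [if_pos hm1, if_pos hm]
    refine Nat.nth_lt_nth' hi fun hf => ?_
    rw [card_setOf_lt, ← h]; exact YoungDiagram.mem_iff_lt_colLen.1 hm
  zeros' := fun hm => if_neg hm

/-- The index `v` occurs exactly once in column `j` when `j < d v` and nowhere else, so its cells
correspond to `range (d v)`. -/
theorem content_keyTableau (D : YoungDiagram) (d : ℕ →₀ ℕ) (h : ∀ s, D.colLen s = colCount d s) :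
    content (keyTableau D d h) = d := by
  classical
  have happ : ∀ i j, (i, j) ∈ D → keyTableau D d h i j = Nat.nth (fun v => j < d v) i :=
    fun i j hm => if_pos hm
  have hlt : ∀ i j, (i, j) ∈ D → ∀ hf : {v | j < d v}.Finite, i < #hf.toFinset := by
    intro i j hm hf
    rw [card_setOf_lt, ← h]; exact YoungDiagram.mem_iff_lt_colLen.1 hm
  ext v
  rw [content_apply, ← Finset.card_range (d v)]
  refine Finset.card_bij (fun c _ => c.2) ?_ ?_ ?_
  · rintro ⟨i, j⟩ hc
    rw [mem_filter, YoungDiagram.mem_cells] at hc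
    rw [happ i j hc.1] at hc
    rw [mem_range]
    have := Nat.nth_mem i (hlt i j hc.1)
    rwa [hc.2] at this
  · rintro ⟨i, j⟩ hc ⟨i', j'⟩ hc' (rfl : j = j')
    rw [mem_filter, YoungDiagram.mem_cells] at hc hc'
    rw [happ i j hc.1] at hc
    rw [happ i' j hc'.1] at hc'
    have := Nat.nth_injOn (finite_setOf_lt d j) (hlt i j hc.1 _) (hlt i' j hc'.1 _)
      (hc.2.trans hc'.2.symm)
    rw [this]
  · intro j hj
    rw [mem_range] at hj
    obtain ⟨i, hi, hv⟩ := Nat.exists_lt_card_finite_nth_eq (p := fun v => j < d v)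
      (finite_setOf_lt d j) hj
    rw [card_setOf_lt, ← h, ← YoungDiagram.mem_iff_lt_colLen] at hi
    exact ⟨(i, j), mem_filter.2 ⟨(YoungDiagram.mem_cells _).2 hi, (happ i j hi).trans hv⟩, rfl⟩

/-- The number of cells that precede a given one in the lexicographic order. -/
def lexRank (D : YoungDiagram) (c : ℕ × ℕ) : ℕ := #{c' ∈ D.cells | toLex c' < toLex c}

theorem lexRank_lt {D : YoungDiagram} {c c' : ℕ × ℕ} (hc : c ∈ D.cells) (h : toLex c < toLex c') :
    lexRank D c < lexRank D c' := by
  refine Finset.card_lt_card ⟨?_, fun hs => ?_⟩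
  · intro x hx
    rw [mem_filter] at hx ⊢
    exact ⟨hx.1, hx.2.trans h⟩
  · have := hs (mem_filter.2 ⟨hc, h⟩)
    exact lt_irrefl _ (mem_filter.1 this).2

theorem lexRank_lt_card {D : YoungDiagram} {c : ℕ × ℕ} (hc : c ∈ D.cells) :
    lexRank D c < #D.cells :=
  Finset.card_lt_card ⟨Finset.filter_subset _ _, fun hs => lt_irrefl _ (mem_filter.1 (hs hc)).2⟩

/-- A tableau in which every element of `S` occurs exactly once. -/
noncomputable def standardTableau (D : YoungDiagram) (S : Finset ℕ) (h : #S = #D.cells) :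
    SemistandardYoungTableau D where
  entry i j := open Classical in if (i, j) ∈ D then Nat.nth (· ∈ S) (lexRank D (i, j)) else 0
  row_weak' := by
    classical
    intro i j₁ j₂ hj hm
    have hm1 : (i, j₁) ∈ D := D.up_left_mem le_rfl hj.le hm
    rw [if_pos hm1, if_pos hm]
    refine Nat.nth_le_nth' (lexRank_lt ((YoungDiagram.mem_cells _).2 hm1) ?_).le fun hf => ?_
    · rw [Prod.Lex.toLex_lt_toLex]; exact Or.inr ⟨rfl, hj⟩
    · have : hf.toFinset = S := by ext; simp
      rw [this, h]
      exact lexRank_lt_card ((YoungDiagram.mem_cells _).2 hm)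
  col_strict' := by
    classical
    intro i₁ i₂ j hi hm
    have hm1 : (i₁, j) ∈ D := D.up_left_mem hi.le le_rfl hm
    rw [if_pos hm1, if_pos hm]
    refine Nat.nth_lt_nth' (lexRank_lt ((YoungDiagram.mem_cells _).2 hm1) ?_) fun hf => ?_
    · rw [Prod.Lex.toLex_lt_toLex]; exact Or.inl hi
    · have : hf.toFinset = S := by ext; simp
      rw [this, h]
      exact lexRank_lt_card ((YoungDiagram.mem_cells _).2 hm)
  zeros' := fun hm => if_neg hm

theorem content_standardTableau (D : YoungDiagram) (S : Finset ℕ) (h : #S = #D.cells) :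
    content (standardTableau D S h) = ∑ v ∈ S, Finsupp.single v 1 := by
  classical
  have happ : ∀ c ∈ D.cells, standardTableau D S h c.1 c.2 = Nat.nth (· ∈ S) (lexRank D c) :=
    fun c hm => if_pos ((YoungDiagram.mem_cells _).1 hm)
  have hfin : (Set.ofPred (· ∈ S)).Finite := S.finite_toSet
  have hS : hfin.toFinset = S := by ext; simp
  have hlt : ∀ c ∈ D.cells, lexRank D c < #hfin.toFinset := fun c hc => by
    rw [hS, h]; exact lexRank_lt_card hc
  have hinj : Set.InjOn (fun c : ℕ × ℕ => standardTableau D S h c.1 c.2) D.cells := by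
    intro c hc c' hc' heq
    simp only [happ c hc, happ c' hc'] at heq
    have := Nat.nth_injOn hfin (hlt c hc) (hlt c' hc') heq
    rcases lt_trichotomy (toLex c) (toLex c') with h1 | h1 | h1
    · exact absurd this (lexRank_lt hc h1).ne
    · exact toLex.injective h1
    · exact absurd this (lexRank_lt hc' h1).ne'
  have himg : D.cells.image (fun c : ℕ × ℕ => standardTableau D S h c.1 c.2) = S := by
    refine Finset.eq_of_subset_of_card_le ?_ ?_
    · intro v hv
      obtain ⟨c, hc, rfl⟩ := mem_image.1 hv
      simp only [happ c hc]
      exact Nat.nth_mem_of_lt_card hfin (hlt c hc)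
    · rw [Finset.card_image_of_injOn hinj, h]
  rw [content, ← Finset.sum_image (f := fun v => Finsupp.single v 1) hinj, himg]

/-! ### The exponents that occur in the Hall pairing -/

/-- `q^m` occurs in the coefficient of `x^a` in `s_λ(𝐱𝐲)`. -/
def IsWeight {n : ℕ} (lam : n.Partition) (a : ℕ →₀ ℕ) (m : ℕ) : Prop :=
  ∃ (β : ℕ × ℕ →₀ ℕ) (T : SemistandardYoungTableau (diagram lam)), β.mapDomain Prod.fst = a ∧
    (β.sum fun p e => p.2 * e) = m ∧ content T = β.equivMapDomain Nat.pairEquiv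

/-- `Nat.card` of an infinite type is `0`, so finiteness is what makes a nonzero Schur coefficient
equivalent to the existence of a tableau. -/
theorem finite_tableaux (D : YoungDiagram) (d : ℕ →₀ ℕ) :
    Finite {T : SemistandardYoungTableau D // content T = d} := by
  refine Finite.of_injective (β := D.cells → d.support)
    (fun T c => ⟨T.1 c.1.1 c.1.2, by
      have := entry_mem_support_content T.1 c.2
      rwa [T.2] at this⟩) ?_
  intro T T' h
  apply Subtype.ext
  ext i j
  by_cases hc : (i, j) ∈ D
  · have := congrFun h ⟨(i, j), (YoungDiagram.mem_cells _).2 hc⟩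
    exact congrArg Subtype.val this
  · rw [T.1.zeros hc, T'.1.zeros hc]

theorem coeff_schur_nonneg (lam : n.Partition) (d : ℕ →₀ ℕ) :
    0 ≤ MvPowerSeries.coeff d (schur lam) := Nat.cast_nonneg _

theorem coeff_schur_ne_zero (lam : n.Partition) (d : ℕ →₀ ℕ) :
    MvPowerSeries.coeff d (schur lam) ≠ 0 ↔
      ∃ T : SemistandardYoungTableau (diagram lam), content T = d := by
  have := finite_tableaux (diagram lam) d
  change ((Nat.card {T : SemistandardYoungTableau (diagram lam) // content T = d} : ℕ) : ℚ) ≠ 0 ↔ _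
  rw [Nat.cast_ne_zero, Nat.card_ne_zero]
  simp [this]

/-- A `finsum` over an infinite support would be `0`. Here `β (p, j) ≤ a p` and, on the support, `j
≤ m`. -/
theorem finite_exponents (a : ℕ →₀ ℕ) (m : ℕ) : {β : ℕ × ℕ →₀ ℕ |
    β.mapDomain Prod.fst = a ∧ (β.sum fun p e => p.2 * e) = m}.Finite := by
  classical
  refine (Set.finite_Iic (Finsupp.indicator (a.support ×ˢ range (m + 1))
    fun v _ => a v.1 : ℕ × ℕ →₀ ℕ)).subset ?_
  rintro β ⟨h1, h2⟩ v
  by_cases hv : v ∈ β.support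
  · have hb : β v ≠ 0 := Finsupp.mem_support_iff.1 hv
    have h3 : v.2 * β v ≤ m := by
      rw [← h2]
      exact Finset.single_le_sum (f := fun v : ℕ × ℕ => v.2 * β v) (fun _ _ => Nat.zero_le _) hv
    have h4 : v.2 ≤ m := (Nat.le_mul_of_pos_right _ (Nat.pos_of_ne_zero hb)).trans h3
    rw [Finsupp.indicator_of_mem (mem_product.2
      ⟨fst_mem_support_of_mapDomain h1 hv, mem_range.2 (by omega)⟩), ← h1, mapDomain_fst_apply]
    have := Finsupp.le_degree v.2 (β.curry v.1)
    rwa [Finsupp.curry_apply] at this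
  · rw [Finsupp.notMem_support_iff.1 hv]
    exact Nat.zero_le _

/-- The summands count tableaux, so they are nonnegative and cannot cancel. The order of the pairing
thereby becomes a combinatorial minimum. -/
theorem weight_sum_ne_zero (lam : n.Partition) (a : ℕ →₀ ℕ) (m : ℕ) :
    (∑ᶠ β ∈ {β : ℕ × ℕ →₀ ℕ | β.mapDomain Prod.fst = a ∧ (β.sum fun p e => p.2 * e) = m},
      MvPowerSeries.coeff (β.equivMapDomain Nat.pairEquiv) (schur lam)) ≠ 0 ↔
        IsWeight lam a m := by
  rw [finsum_mem_eq_finite_toFinset_sum _ (finite_exponents a m), Ne,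
    Finset.sum_eq_zero_iff_of_nonneg fun _ _ => coeff_schur_nonneg _ _]
  push Not
  constructor
  · rintro ⟨β, hβ, hne⟩
    obtain ⟨T, hT⟩ := (coeff_schur_ne_zero _ _).1 hne
    rw [Set.Finite.mem_toFinset] at hβ
    exact ⟨β, T, hβ.1, hβ.2, hT⟩
  · rintro ⟨β, T, h1, h2, hT⟩
    exact ⟨β, (Set.Finite.mem_toFinset _).2 ⟨h1, h2⟩, (coeff_schur_ne_zero _ _).2 ⟨T, hT⟩⟩

/-- The 0/1 matrix supported on the diagram of `ν` has row sums `ν` and uses `n` distinct variables,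
so a tableau with distinct entries has this content for any shape. -/
theorem exists_isWeight (lam ν : n.Partition) : ∃ m, IsWeight lam (exponent ν) m := by
  classical
  let S : Finset (ℕ × ℕ) := (diagram ν).cells
  have hcard : #(S.map Nat.pairEquiv.toEmbedding) = #(diagram lam).cells := by
    rw [Finset.card_map, card_diagram, card_diagram]
  refine ⟨_, ∑ v ∈ S, Finsupp.single v 1, standardTableau _ _ hcard, ?_, rfl, ?_⟩
  · rw [Finsupp.mapDomain_finsetSum]
    ext p
    simp only [Finsupp.mapDomain_single, Finsupp.finsetSum_apply, Finsupp.single_apply]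
    rw [← Finset.card_filter, exponent_apply, ← rowLen_diagram, YoungDiagram.rowLen_eq_card]
    rfl
  · rw [content_standardTableau, Finset.sum_map, Finsupp.equivMapDomain_eq_mapDomain,
      Finsupp.mapDomain_finsetSum]
    simp

theorem degree_exponent (ν : n.Partition) : (exponent ν).degree = n := by
  have : (exponent ν).degree = ∑ p ∈ (exponent ν).support, exponent ν p := rfl
  rw [this, support_exponent]
  simp only [exponent_apply]
  exact sum_part ν

theorem colCount_exponent (ν : n.Partition) (s : ℕ) :
    colCount (exponent ν) s = (diagram ν).colLen s := by
  rw [colLen_diagram, colCount, support_exponent, ← card_filter_lt_part]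
  simp only [exponent_apply]

/-- If `λ` is the union of partitions `ν_p` of the parts of `μ`, then `∑ n(ν_p)` is the degree of
a monomial in the pairing. -/
theorem isWeight_of_union (lam μ : n.Partition) (ν : ∀ p, (part μ p).Partition)
    (h : ∑ p ∈ range (rows μ).length, (ν p).parts = lam.parts) :
    IsWeight lam (exponent μ) (∑ p ∈ range (rows μ).length, nStat (ν p)) := by
  let γ : ℕ →₀ ℕ →₀ ℕ := Finsupp.onFinset (range (rows μ).length) (fun p => exponent (ν p)) (by
    intro p hp
    by_contra hn
    apply hp
    have : part μ p = 0 := part_of_le μ (by simpa using hn)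
    rw [← Finsupp.degree_eq_zero_iff, degree_exponent, this])
  have hcur : ∀ p, γ.uncurry.curry p = exponent (ν p) := fun p => by
    rw [Finsupp.curry_uncurry]; rfl
  have hP : ∀ v ∈ γ.uncurry.support, v.1 ∈ range (rows μ).length := by
    intro v hv
    rw [Finsupp.mem_support_iff] at hv
    have h2 : γ v.1 v.2 ≠ 0 := hv
    by_contra hn
    apply h2
    have : γ v.1 = 0 := by
      have h3 : part μ v.1 = 0 := part_of_le μ (by simpa using hn)
      change exponent (ν v.1) = 0
      rw [← Finsupp.degree_eq_zero_iff, degree_exponent, h3]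
    rw [this]; rfl
  -- Row `p` of the matrix is `ν p`, and columns add under unions; this is the hypothesis under
  -- which the key tableau exists.
  have hcol : ∀ s, (diagram lam).colLen s = colCount (γ.uncurry.equivMapDomain Nat.pairEquiv) s := by
    intro s
    rw [colCount_equivMapDomain, colCount_eq_sum_curry _ hP, colLen_diagram, ← h]
    rw [← Multiset.coe_countPAddMonoidHom, map_sum]
    refine Finset.sum_congr rfl fun p _ => ?_
    rw [hcur, colCount_exponent, colLen_diagram]
    rfl
  refine ⟨γ.uncurry, keyTableau _ _ hcol, ?_, ?_, content_keyTableau _ _ hcol⟩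
  · ext p
    rw [mapDomain_fst_apply, hcur, degree_exponent, exponent_apply]
  · rw [Finsupp.sum, sum_eq_sum_curry _ hP (fun _ j e => j * e)]
    refine Finset.sum_congr rfl fun p _ => ?_
    rw [hcur, nStat, support_exponent]
    simp only [exponent_apply]

/-! ### The order of the Hall pairing -/

theorem order_ofPowerSeries_eq {f : PowerSeries ℚ} {m : ℕ} (hm : PowerSeries.coeff m f ≠ 0)
    (hmin : ∀ j < m, PowerSeries.coeff j f = 0) :
    HahnSeries.ofPowerSeries ℤ ℚ f ≠ 0 ∧ (HahnSeries.ofPowerSeries ℤ ℚ f).order = m := by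
  have hc : (HahnSeries.ofPowerSeries ℤ ℚ f).coeff (m : ℤ) ≠ 0 := by
    rwa [HahnSeries.ofPowerSeries_apply_coeff]
  have hne : HahnSeries.ofPowerSeries ℤ ℚ f ≠ 0 := fun h => hc (by rw [h]; rfl)
  refine ⟨hne, le_antisymm (HahnSeries.order_le_of_coeff_ne_zero hc) ?_⟩
  rw [HahnSeries.le_order_iff_forall hne]
  intro j hj
  have := PowerSeries.coeff_coe f j
  rw [this]
  split_ifs with h
  · rfl
  · exact hmin _ (by omega)

/-- The pairing is a power series in `q` whose support is the set of weights. That set is nonempty,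
and its least element is the order. -/
theorem order_hallPairing (lam ν : n.Partition) :
    hallPairing (completeHPart (LaurentSeries ℚ) ν) (evalXY (schur lam)) ≠ 0 ∧
    ∃ m : ℕ, (hallPairing (completeHPart (LaurentSeries ℚ) ν) (evalXY (schur lam))).order = m ∧
      IsWeight lam (exponent ν) m ∧ ∀ m', IsWeight lam (exponent ν) m' → m ≤ m' := by
  classical
  have hex := exists_isWeight lam ν
  rw [hallPairing_completeHPart]
  have hm := Nat.find_spec hex
  have key := order_ofPowerSeries_eq (f := PowerSeries.mk fun m =>
    ∑ᶠ β ∈ {β : ℕ × ℕ →₀ ℕ | β.mapDomain Prod.fst = exponent ν ∧ (β.sum fun p e => p.2 * e) = m},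
      MvPowerSeries.coeff (β.equivMapDomain Nat.pairEquiv) (schur lam)) (m := Nat.find hex)
    (by rw [PowerSeries.coeff_mk]; exact (weight_sum_ne_zero _ _ _).2 hm)
    (by
      intro j hj
      rw [PowerSeries.coeff_mk]
      by_contra h
      exact Nat.find_min hex hj ((weight_sum_ne_zero _ _ _).1 h))
  exact ⟨key.1, _, key.2, hm, fun m' h => Nat.find_min' hex h⟩

/-! ### The quadratic inequality -/

section Quadratic

variable {ι κ : Type*} (P : Finset ι) (S : Finset κ) (x : ι → κ → ℚ) (a : ι → ℚ)

/-- For each `s`, with `c` the column total, the last sum is the defect in the Cauchy–Schwarz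
inequality `c² ≤ n ∑_p x_{ps}² / a_p`. The remaining terms collect row by row with weights `(M -
a_p) / a_p`, nonnegative when `M` bounds the `a_p`. -/
theorem quadratic_identity (ha : ∀ p ∈ P, 0 < a p) (M n : ℚ) (hn : ∑ p ∈ P, a p = n)
    (hn0 : n ≠ 0) :
    M * n ^ 2 - n * ∑ p ∈ P, a p ^ 2 + n * ∑ p ∈ P, ∑ s ∈ S, x p s ^ 2
        - M * ∑ s ∈ S, (∑ p ∈ P, x p s) ^ 2 =
      n * ∑ p ∈ P, (M - a p) / a p * (a p ^ 2 - ∑ s ∈ S, x p s ^ 2) +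
        M * n * ∑ s ∈ S, ∑ p ∈ P, (x p s - a p * (∑ r ∈ P, x r s) / n) ^ 2 / a p := by
  have h1 : ∀ s, n * ∑ p ∈ P, (x p s - a p * (∑ r ∈ P, x r s) / n) ^ 2 / a p =
      n * ∑ p ∈ P, x p s ^ 2 / a p - (∑ p ∈ P, x p s) ^ 2 := by
    intro s
    set c := ∑ r ∈ P, x r s with hc
    have : ∀ p ∈ P, (x p s - a p * c / n) ^ 2 / a p =
        x p s ^ 2 / a p - 2 * c / n * x p s + c ^ 2 / n ^ 2 * a p := by
      intro p hp
      have := (ha p hp).ne'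
      field_simp
      ring
    rw [Finset.sum_congr rfl this, Finset.sum_add_distrib, Finset.sum_sub_distrib,
      ← Finset.mul_sum, ← Finset.mul_sum, hn, ← hc]
    field_simp
    ring
  have h2 : ∑ p ∈ P, (M - a p) / a p * (a p ^ 2 - ∑ s ∈ S, x p s ^ 2) =
      M * n - ∑ p ∈ P, a p ^ 2 - M * (∑ s ∈ S, ∑ p ∈ P, x p s ^ 2 / a p) +
        ∑ p ∈ P, ∑ s ∈ S, x p s ^ 2 := by
    rw [Finset.sum_comm (s := S), ← hn, Finset.mul_sum, Finset.mul_sum, ← Finset.sum_sub_distrib,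
      ← Finset.sum_sub_distrib, ← Finset.sum_add_distrib]
    refine Finset.sum_congr rfl fun p hp => ?_
    rw [← Finset.sum_div]
    have := (ha p hp).ne'
    field_simp
    ring
  rw [h2, mul_assoc M n, Finset.mul_sum S _ n, Finset.sum_congr rfl fun s _ => h1 s,
    Finset.sum_sub_distrib, ← Finset.mul_sum]
  ring

variable {P S x a}

theorem sum_sq_le_sq_sum {f : κ → ℚ} (hf : ∀ s ∈ S, 0 ≤ f s) :
    ∑ s ∈ S, f s ^ 2 ≤ (∑ s ∈ S, f s) ^ 2 := by
  rw [sq (∑ s ∈ S, f s), Finset.sum_mul]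
  refine Finset.sum_le_sum fun s hs => ?_
  rw [sq]
  exact mul_le_mul_of_nonneg_left (Finset.single_le_sum hf hs) (hf s hs)

theorem quadratic_terms_nonneg (ha : ∀ p ∈ P, 0 < a p) (hx : ∀ p ∈ P, ∀ s ∈ S, 0 ≤ x p s)
    (hxa : ∀ p ∈ P, ∑ s ∈ S, x p s = a p) {M : ℚ} (hM : ∀ p ∈ P, a p ≤ M) :
    ∀ p ∈ P, 0 ≤ (M - a p) / a p * (a p ^ 2 - ∑ s ∈ S, x p s ^ 2) := by
  intro p hp
  refine mul_nonneg (div_nonneg (sub_nonneg.2 (hM p hp)) (ha p hp).le) (sub_nonneg.2 ?_)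
  rw [← hxa p hp]
  exact sum_sq_le_sq_sum (hx p hp)

theorem quadratic_nonneg (ha : ∀ p ∈ P, 0 < a p) (hx : ∀ p ∈ P, ∀ s ∈ S, 0 ≤ x p s)
    (hxa : ∀ p ∈ P, ∑ s ∈ S, x p s = a p) {M n : ℚ} (hM : ∀ p ∈ P, a p ≤ M)
    (hn : ∑ p ∈ P, a p = n) (hn0 : 0 < n) (hM0 : 0 < M) :
    0 ≤ M * n ^ 2 - n * ∑ p ∈ P, a p ^ 2 + n * ∑ p ∈ P, ∑ s ∈ S, x p s ^ 2
        - M * ∑ s ∈ S, (∑ p ∈ P, x p s) ^ 2 := by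
  rw [quadratic_identity P S x a ha M n hn hn0.ne']
  refine add_nonneg (mul_nonneg hn0.le (Finset.sum_nonneg (quadratic_terms_nonneg ha hx hxa hM)))
    (mul_nonneg (mul_pos hM0 hn0).le (Finset.sum_nonneg fun s _ => Finset.sum_nonneg fun p hp =>
      div_nonneg (sq_nonneg _) (ha p hp).le))

/-- Vanishing squares make each row proportional to the column totals, with factor `a_p / n`. The
other terms then give, for each row, either `a_p = M` or `∑_s x_{ps}² = a_p²`, and by
proportionality the latter says that the totals have sum of squares `n²`. -/
theorem quadratic_eq_zero (ha : ∀ p ∈ P, 0 < a p) (hx : ∀ p ∈ P, ∀ s ∈ S, 0 ≤ x p s)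
    (hxa : ∀ p ∈ P, ∑ s ∈ S, x p s = a p) {M n : ℚ} (hM : ∀ p ∈ P, a p ≤ M)
    (hn : ∑ p ∈ P, a p = n) (hn0 : 0 < n) (hM0 : 0 < M)
    (h0 : M * n ^ 2 - n * ∑ p ∈ P, a p ^ 2 + n * ∑ p ∈ P, ∑ s ∈ S, x p s ^ 2
        - M * ∑ s ∈ S, (∑ p ∈ P, x p s) ^ 2 = 0) :
    ∑ s ∈ S, (∑ p ∈ P, x p s) ^ 2 = n ^ 2 ∨
      ∀ p ∈ P, a p = M ∧ ∀ s ∈ S, #P * x p s = ∑ r ∈ P, x r s := by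
  rw [quadratic_identity P S x a ha M n hn hn0.ne'] at h0
  have hA := Finset.sum_nonneg (quadratic_terms_nonneg ha hx hxa hM)
  have hB0 : ∀ s ∈ S, 0 ≤ ∑ p ∈ P, (x p s - a p * (∑ r ∈ P, x r s) / n) ^ 2 / a p :=
    fun s _ => Finset.sum_nonneg fun p hp => div_nonneg (sq_nonneg _) (ha p hp).le
  have hB := Finset.sum_nonneg hB0
  have hA' := mul_nonneg hn0.le hA
  have hB' := mul_nonneg (mul_pos hM0 hn0).le hB
  have hA1 := (mul_eq_zero.1 (le_antisymm (by linarith) hA')).resolve_left hn0.ne'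
  have hB1 := (mul_eq_zero.1 (le_antisymm (by linarith) hB')).resolve_left (mul_pos hM0 hn0).ne'
  have hprop : ∀ p ∈ P, ∀ s ∈ S, x p s = a p * (∑ r ∈ P, x r s) / n := by
    intro p hp s hs
    have h1 := (Finset.sum_eq_zero_iff_of_nonneg hB0).1 hB1 s hs
    have h2 := (Finset.sum_eq_zero_iff_of_nonneg fun p hp =>
      div_nonneg (sq_nonneg _) (ha p hp).le).1 h1 p hp
    have h3 := (div_eq_zero_iff.1 h2).resolve_right (ha p hp).ne'
    exact sub_eq_zero.1 (pow_eq_zero_iff two_ne_zero |>.1 h3)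
  by_cases hc : ∑ s ∈ S, (∑ p ∈ P, x p s) ^ 2 = n ^ 2
  · exact Or.inl hc
  right
  have haM : ∀ p ∈ P, a p = M := by
    intro p hp
    have h1 := (Finset.sum_eq_zero_iff_of_nonneg (quadratic_terms_nonneg ha hx hxa hM)).1 hA1 p hp
    rcases mul_eq_zero.1 h1 with h2 | h2
    · have := (div_eq_zero_iff.1 h2).resolve_right (ha p hp).ne'
      linarith
    · exfalso
      apply hc
      have h3 : ∑ s ∈ S, x p s ^ 2 = a p ^ 2 / n ^ 2 * ∑ s ∈ S, (∑ r ∈ P, x r s) ^ 2 := by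
        rw [Finset.mul_sum]
        refine Finset.sum_congr rfl fun s hs => ?_
        rw [hprop p hp s hs]; ring
      rw [h3] at h2
      have := (ha p hp).ne'
      have h4 : a p ^ 2 * (n ^ 2 - ∑ s ∈ S, (∑ r ∈ P, x r s) ^ 2) = 0 := by
        field_simp at h2
        linarith
      have h5 := (mul_eq_zero.1 h4).resolve_left (pow_ne_zero 2 this)
      linarith
  refine fun p hp => ⟨haM p hp, fun s hs => ?_⟩
  have hnM : n = #P * M := by
    rw [← hn, Finset.sum_congr rfl haM, Finset.sum_const, nsmul_eq_mul]
  have hx' := hprop p hp s hs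
  rw [haM p hp] at hx'
  rw [eq_div_iff hn0.ne', hnM] at hx'
  have : M * (#P * x p s) = M * ∑ r ∈ P, x r s := by linarith
  exact mul_left_cancel₀ hM0.ne' this

end Quadratic

/-! ### The gap between `v(λ)` and `v((1^n))` -/

/-- The contribution of `μ` to `2 n (v(λ) - v((1^n)))`, with `m` the order of the pairing. -/
def gap (lam μ : n.Partition) (m : ℕ) : ℚ :=
  part μ 0 * ((n : ℚ) ^ 2 - (2 * nStat lam + n)) -
    n * (∑ p ∈ range (rows μ).length, (part μ p : ℚ) ^ 2 - (2 * m + n))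

theorem length_pos (hn : 0 < n) (μ : n.Partition) : 0 < (rows μ).length := by
  by_contra h
  have := sum_part μ
  rw [Nat.eq_zero_of_not_pos h] at this
  simp at this
  omega

/-- The gap is the sum of three slacks: that of the quadratic inequality, that of `∑ x² ≤ 2m + n`,
and that of the dominance bound. If it vanishes, the columns of `λ` are the totals `c_s`, and the
equality case of the quadratic inequality applies. -/
theorem gap_nonneg_and_eq_zero (hn : 0 < n) {lam μ : n.Partition} {m : ℕ}
    (h : IsWeight lam (exponent μ) m) :
    0 ≤ gap lam μ m ∧ (gap lam μ m = 0 → lam = ones n ∨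
      ((∀ p < (rows μ).length, part μ p = part μ 0) ∧
        ∀ s, (rows μ).length ∣ (diagram lam).colLen s)) := by
  obtain ⟨β, T, h1, h2, hT⟩ := h
  set ℓ := (rows μ).length with hℓ
  have hP : ∀ v ∈ β.support, v.1 ∈ range ℓ := fun v hv => by
    rw [hℓ, ← support_exponent]; exact fst_mem_support_of_mapDomain h1 hv
  have hdeg : ∀ p, (β.curry p).degree = part μ p := fun p => by
    rw [← mapDomain_fst_apply, h1, exponent_apply]
  have hpn : ∀ p ∈ range ℓ, part μ p ≤ n := fun p hp => by
    conv_rhs => rw [← sum_part μ]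
    exact Finset.single_le_sum (f := fun p => part μ p) (fun _ _ => Nat.zero_le _) hp
  -- `x p s` is the `s`-th column length of row `p` of `β`, rearranged into a partition of `μ_p`.
  let x : ℕ → ℕ → ℚ := fun p s => colCount (β.curry p) s
  let a : ℕ → ℚ := fun p => part μ p
  have ha : ∀ p ∈ range ℓ, 0 < a p := fun p hp => by
    simp only [a]
    exact_mod_cast (part_pos_iff μ).2 (mem_range.1 hp)
  have hx : ∀ p ∈ range ℓ, ∀ s ∈ range n, 0 ≤ x p s := fun p _ s _ => Nat.cast_nonneg _
  have hxa : ∀ p ∈ range ℓ, ∑ s ∈ range n, x p s = a p := fun p hp => by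
    have := sum_colCount (β.curry p) (r := n) (by rw [hdeg]; exact hpn p hp)
    rw [hdeg] at this
    simp only [x, a]
    exact_mod_cast this
  have hM : ∀ p ∈ range ℓ, a p ≤ (part μ 0 : ℚ) := fun p _ => by
    simp only [a]
    exact_mod_cast part_anti μ (Nat.zero_le p)
  have hsum : ∑ p ∈ range ℓ, a p = (n : ℚ) := by
    simp only [a]
    exact_mod_cast sum_part μ
  have hn0 : (0 : ℚ) < n := by exact_mod_cast hn
  have hM0 : (0 : ℚ) < part μ 0 := by exact_mod_cast (part_pos_iff μ).2 (length_pos hn μ)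
  have hcol : ∀ s, (colCount (content T) s : ℚ) = ∑ p ∈ range ℓ, x p s := fun s => by
    rw [hT, colCount_equivMapDomain, colCount_eq_sum_curry β hP]
    push_cast; rfl
  have hdom := sum_colLen_sq_add_le T (card_diagram lam)
  simp only [hcol] at hdom
  have hN : ∑ s ∈ range n, ((diagram lam).colLen s : ℚ) ^ 2 = 2 * nStat lam + n := by
    exact_mod_cast (two_mul_nStat_add lam).symm
  rw [hN] at hdom
  have hm : ∑ p ∈ range ℓ, ∑ s ∈ range n, x p s ^ 2 ≤ 2 * m + n := by
    have h3 : ∀ p ∈ range ℓ, ∑ s ∈ range n, colCount (β.curry p) s ^ 2 ≤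
        2 * ((β.curry p).sum fun j e => j * e) + part μ p := fun p hp => by
      have := sum_colCount_sq_le (β.curry p) (r := n) (by rw [hdeg]; exact hpn p hp)
      rwa [hdeg] at this
    have h4 := Finset.sum_le_sum h3
    rw [Finset.sum_add_distrib, sum_part μ, ← Finset.mul_sum] at h4
    have h5 : ∑ p ∈ range ℓ, ((β.curry p).sum fun j e => j * e) = m := by
      rw [← h2]
      exact (sum_eq_sum_curry β hP (fun _ j e => j * e)).symm
    rw [h5] at h4
    simp only [x]
    exact_mod_cast h4
  have hquad := quadratic_nonneg ha hx hxa hM hsum hn0 hM0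
  have hm' := mul_le_mul_of_nonneg_left hm hn0.le
  have hsq : 0 ≤ ∑ s ∈ range n, (∑ p ∈ range ℓ, x p s - ((diagram lam).colLen s : ℚ)) ^ 2 :=
    Finset.sum_nonneg fun _ _ => sq_nonneg _
  have hdom' := mul_le_mul_of_nonneg_left hdom hM0.le
  have hsq' := mul_nonneg hM0.le hsq
  have hgap : gap lam μ m = part μ 0 * (n : ℚ) ^ 2 - part μ 0 * (2 * nStat lam + n) -
    n * ∑ p ∈ range ℓ, a p ^ 2 + n * (2 * m + n) := by unfold gap; ring
  refine ⟨by rw [hgap]; linarith, fun h0 => ?_⟩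
  rw [hgap] at h0
  have hsq0 := (mul_eq_zero.1 (le_antisymm (by linarith) hsq')).resolve_left hM0.ne'
  have hcs : ∀ s ∈ range n, ∑ p ∈ range ℓ, x p s = ((diagram lam).colLen s : ℚ) := fun s hs =>
    sub_eq_zero.1 (pow_eq_zero_iff two_ne_zero |>.1
      ((Finset.sum_eq_zero_iff_of_nonneg fun _ _ => sq_nonneg _).1 hsq0 s hs))
  rcases quadratic_eq_zero ha hx hxa hM hsum hn0 hM0 (by linarith) with h3 | h3
  · left
    rw [Finset.sum_congr rfl fun s hs => by rw [hcs s hs], hN] at h3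
    exact eq_ones_of_nStat lam (by exact_mod_cast h3)
  · right
    simp only [a, x] at h3
    refine ⟨fun p hp => by exact_mod_cast (h3 p (mem_range.2 hp)).1, fun s => ?_⟩
    by_cases hs : s < n
    · have h4 := (h3 0 (mem_range.2 (length_pos hn μ))).2 s (mem_range.2 hs)
      have h5 := hcs s (mem_range.2 hs)
      simp only [x] at h5
      rw [h5, card_range] at h4
      exact ⟨colCount (β.curry 0) s, by exact_mod_cast h4.symm⟩
    -- The quadratic inequality sees only columns below `n`; the others are empty because no part
    -- exceeds `n`.
    · have : (diagram lam).colLen s = 0 := by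
        rw [colLen_diagram, Multiset.countP_eq_zero]
        intro b hb
        have := Multiset.single_le_sum (fun _ _ => Nat.zero_le _) b hb
        rw [lam.parts_sum] at this
        omega
      rw [this]; exact dvd_zero _

theorem two_mul_add_le_of_union {lam μ : n.Partition} {m : ℕ} (ν : ∀ p, (part μ p).Partition)
    (h : ∑ p ∈ range (rows μ).length, (ν p).parts = lam.parts)
    (hmin : ∀ m', IsWeight lam (exponent μ) m' → m ≤ m') :
    2 * m + n ≤ ∑ p ∈ range (rows μ).length, (2 * nStat (ν p) + part μ p) := by
  have := hmin _ (isWeight_of_union lam μ ν h)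
  rw [Finset.sum_add_distrib, sum_part, ← Finset.mul_sum]
  omega

theorem sum_parts_ones (μ : n.Partition) :
    ∑ p ∈ range (rows μ).length, (ones (part μ p)).parts = (ones n).parts := by
  simp only [parts_ones]
  refine Eq.trans ?_ (congrArg (Multiset.replicate · 1) (sum_part μ))
  generalize range (rows μ).length = P
  induction P using Finset.induction_on with
  | empty => simp
  | insert p P hp ih => rw [Finset.sum_insert hp, Finset.sum_insert hp, ih, Multiset.replicate_add]

/-- The order of the pairing for `λ = (1^n)`. -/
theorem two_mul_order_ones (hn : 0 < n) {μ : n.Partition} {m : ℕ}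
    (hm : IsWeight (ones n) (exponent μ) m)
    (hmin : ∀ m', IsWeight (ones n) (exponent μ) m' → m ≤ m') :
    2 * m + n = ∑ p ∈ range (rows μ).length, part μ p ^ 2 := by
  apply le_antisymm
  · refine (two_mul_add_le_of_union (fun p => ones (part μ p)) (sum_parts_ones μ) hmin).trans_eq ?_
    exact Finset.sum_congr rfl fun p _ => two_mul_nStat_ones_add _
  -- For `λ = (1^n)` the term with `N(λ)` cancels from the gap, and its nonnegativity is the lower
  -- bound for `m`. The upper bound came from splitting `(1^n)` into the `(1^{μ_p})`.
  · have h := (gap_nonneg_and_eq_zero hn hm).1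
    have h1 : (2 * nStat (ones n) + n : ℚ) = n ^ 2 := by exact_mod_cast two_mul_nStat_ones_add n
    rw [gap, h1, sub_self, mul_zero, zero_sub, ← mul_neg] at h
    have hn0 : (0 : ℚ) < n := by exact_mod_cast hn
    have := nonneg_of_mul_nonneg_right h hn0
    have h2 : ∑ p ∈ range (rows μ).length, (part μ p : ℚ) ^ 2 ≤ 2 * m + n := by linarith
    exact_mod_cast h2

/-- The gap vanishes if `μ` is rectangular with `ℓ` rows and `λ` is the union of `ℓ` copies of a
partition. -/
theorem gap_eq_zero_of_copies (hn : 0 < n) {lam μ : n.Partition} {m : ℕ}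
    (hm : IsWeight lam (exponent μ) m)
    (hmin : ∀ m', IsWeight lam (exponent μ) m' → m ≤ m')
    (hrect : ∀ p < (rows μ).length, part μ p = part μ 0)
    (ν : (part μ 0).Partition) (hν : lam.parts = (rows μ).length • ν.parts) :
    gap lam μ m = 0 := by
  refine le_antisymm ?_ (gap_nonneg_and_eq_zero hn hm).1
  set ℓ := (rows μ).length with hℓ
  have hnl : n = ℓ * part μ 0 := by
    conv_lhs => rw [← sum_part μ]
    rw [Finset.sum_congr rfl fun p hp => hrect p (mem_range.1 hp)]
    simp [hℓ]
  -- Transport of `ν` to each row; for `p` with a different part, which do not occur below `ℓ`, the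
  -- value is a filler.
  let ν' : ∀ p, (part μ p).Partition := fun p =>
    if h : part μ p = part μ 0 then h ▸ ν else ones _
  have hcast : ∀ {b c : ℕ} (h : b = c) (κ : c.Partition), (h ▸ κ : b.Partition).parts = κ.parts ∧
      nStat (h ▸ κ : b.Partition) = nStat κ := by
    intro b c h κ; subst h; exact ⟨rfl, rfl⟩
  have hp : ∀ p ∈ range ℓ, (ν' p).parts = ν.parts ∧ nStat (ν' p) = nStat ν := by
    intro p hp
    simp only [ν', dif_pos (hrect p (mem_range.1 hp))]
    exact hcast (hrect p (mem_range.1 hp)) ν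
  have hle := two_mul_add_le_of_union ν' (by
    rw [Finset.sum_congr rfl fun p h => (hp p h).1, hν, Finset.sum_const, card_range]) hmin
  rw [Finset.sum_congr rfl fun p h => by rw [(hp p h).2, hrect p (mem_range.1 h)],
    Finset.sum_const, card_range, smul_eq_mul] at hle
  have hcol : ∀ s, (diagram lam).colLen s = ℓ * (diagram ν).colLen s := fun s => by
    rw [colLen_diagram, colLen_diagram, hν, Multiset.countP_nsmul]
  have hMn : part μ 0 ≤ n :=
    (Nat.le_mul_of_pos_left _ (length_pos hn μ)).trans_eq hnl.symm
  have hN : 2 * nStat lam + n = ℓ ^ 2 * (2 * nStat ν + part μ 0) := by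
    have h1 := two_mul_sum_fst_add_card (diagram ν) (r := n) (by rw [card_diagram]; exact hMn)
    rw [sum_fst_diagram, card_diagram] at h1
    rw [two_mul_nStat_add, h1, Finset.mul_sum]
    exact Finset.sum_congr rfl fun s _ => by rw [hcol, mul_pow]
  have hsq : ∑ p ∈ range ℓ, (part μ p : ℚ) ^ 2 = ℓ * (part μ 0 : ℚ) ^ 2 := by
    rw [Finset.sum_congr rfl fun p h => by rw [hrect p (mem_range.1 h)]]
    simp
  have hN' : (2 * nStat lam + n : ℚ) = ℓ ^ 2 * (2 * nStat ν + part μ 0) := by exact_mod_cast hN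
  have hle' : (2 * m + n : ℚ) ≤ ℓ * (2 * nStat ν + part μ 0) := by exact_mod_cast hle
  have hnl' : (n : ℚ) = ℓ * part μ 0 := by exact_mod_cast hnl
  have hn0 : (0 : ℚ) ≤ n := Nat.cast_nonneg n
  rw [gap, hN', ← hℓ, hsq]
  have := mul_le_mul_of_nonneg_left hle' hn0
  -- With `N(λ) = ℓ² N(ν)` and `n = ℓ μ_1`, replacing `2m + n` by its upper bound `ℓ N(ν)` makes the
  -- gap cancel exactly.
  have e : (part μ 0 : ℚ) * ((n : ℚ) ^ 2 - ℓ ^ 2 * (2 * nStat ν + part μ 0)) -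
      n * (ℓ * (part μ 0 : ℚ) ^ 2 - ℓ * (2 * nStat ν + part μ 0)) = 0 := by
    rw [hnl']; ring
  linarith

/-! ### The valuation of `𝒜_{λμ}(q)` -/

theorem order_inv_of_ne_zero {x : LaurentSeries ℚ} (hx : x ≠ 0) : (x⁻¹).order = -x.order := by
  have h := HahnSeries.order_mul hx (inv_ne_zero hx)
  rw [mul_inv_cancel₀ hx, HahnSeries.order_one] at h
  linarith

theorem order_zpow_of_ne_zero {x : LaurentSeries ℚ} (hx : x ≠ 0) (z : ℤ) :
    (x ^ z).order = z * x.order := by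
  rcases z with m | m
  · rw [Int.ofNat_eq_natCast, zpow_natCast, HahnSeries.order_pow, nsmul_eq_mul]
  · rw [zpow_negSucc, order_inv_of_ne_zero (pow_ne_zero _ hx), HahnSeries.order_pow, nsmul_eq_mul,
      Int.negSucc_eq]
    push_cast
    ring

theorem order_prod_of_ne_zero {ι : Type*} (s : Finset ι) (f : ι → LaurentSeries ℚ)
    (hf : ∀ i ∈ s, f i ≠ 0) :
    (∏ i ∈ s, f i).order = ∑ i ∈ s, (f i).order := by
  classical
  induction s using Finset.induction_on with
  | empty => simp
  | insert i s hi ih =>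
    have h1 : ∀ j ∈ s, f j ≠ 0 := fun j hj => hf j (mem_insert_of_mem hj)
    rw [Finset.prod_insert hi, Finset.sum_insert hi, HahnSeries.order_mul
      (hf i (mem_insert_self i s)) (Finset.prod_ne_zero_iff.2 h1), ih h1]

theorem qVar_ne_zero : qVar ≠ 0 := by
  rw [qVar, Ne, HahnSeries.single_eq_zero_iff]
  exact one_ne_zero

theorem order_qVar : qVar.order = 1 := HahnSeries.order_single one_ne_zero

/-- Hook lengths are positive, so every factor has constant term 1. -/
theorem hookPoly_ne_zero_and_order (lam : n.Partition) :
    hookPoly lam ≠ 0 ∧ (hookPoly lam).order = 0 := by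
  have h : hookPoly lam = HahnSeries.ofPowerSeries ℤ ℚ (∏ c ∈ (diagram lam).cells,
      (1 - PowerSeries.X ^ hookLength (diagram lam) c)) := by
    rw [map_prod, hookPoly]
    refine Finset.prod_congr rfl fun c _ => ?_
    rw [map_sub, map_one, map_pow, HahnSeries.ofPowerSeries_X, qVar]
  rw [h]
  have := order_ofPowerSeries_eq (f := ∏ c ∈ (diagram lam).cells,
      (1 - PowerSeries.X ^ hookLength (diagram lam) c)) (m := 0) (by
    rw [PowerSeries.coeff_zero_eq_constantCoeff_apply, map_prod, Finset.prod_ne_zero_iff]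
    intro c _
    simp [hookLength]) (by simp)
  exact_mod_cast this

/-- The order of the pairing of `h_ν` with `s_λ(𝐱𝐲)`. -/
noncomputable def pairingOrder (lam ν : n.Partition) : ℕ := (order_hallPairing lam ν).2.choose

theorem order_hallPairing_eq (lam ν : n.Partition) :
    (hallPairing (completeHPart (LaurentSeries ℚ) ν) (evalXY (schur lam))).order =
      pairingOrder lam ν := (order_hallPairing lam ν).2.choose_spec.1

theorem isWeight_pairingOrder (lam ν : n.Partition) :
    IsWeight lam (exponent ν) (pairingOrder lam ν) := (order_hallPairing lam ν).2.choose_spec.2.1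

theorem pairingOrder_le (lam ν : n.Partition) (m : ℕ) (h : IsWeight lam (exponent ν) m) :
    pairingOrder lam ν ≤ m := (order_hallPairing lam ν).2.choose_spec.2.2 m h

variable {k : ℕ} (g : ℕ) (μ : Fin k → n.Partition) (lam : n.Partition)

theorem calA_ne_zero : calA g μ lam ≠ 0 := by
  refine mul_ne_zero (mul_ne_zero (zpow_ne_zero _ qVar_ne_zero) (zpow_ne_zero _
    (mul_ne_zero (zpow_ne_zero _ qVar_ne_zero) (hookPoly_ne_zero_and_order lam).1))) ?_
  exact Finset.prod_ne_zero_iff.2 fun i _ => (order_hallPairing lam (μ i)).1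

theorem valuationA_eq : valuationA g μ lam =
    (1 - (g : ℤ)) * n - (2 * (g : ℤ) + k - 2) * nStat lam + ∑ i, (pairingOrder lam (μ i) : ℤ) := by
  have h1 := zpow_ne_zero ((1 - (g : ℤ)) * n) qVar_ne_zero
  have h2 := zpow_ne_zero (-(nStat lam : ℤ)) qVar_ne_zero
  have h3 := mul_ne_zero h2 (hookPoly_ne_zero_and_order lam).1
  have h4 := zpow_ne_zero (2 * (g : ℤ) + k - 2) h3
  have h5 : ∀ i ∈ (univ : Finset (Fin k)), hallPairing (completeHPart (LaurentSeries ℚ) (μ i))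
    (evalXY (schur lam)) ≠ 0 := fun i _ => (order_hallPairing lam (μ i)).1
  rw [valuationA, calA, HahnSeries.order_mul (mul_ne_zero h1 h4) (Finset.prod_ne_zero_iff.2 h5),
    HahnSeries.order_mul h1 h4, order_zpow_of_ne_zero qVar_ne_zero, order_zpow_of_ne_zero h3,
    HahnSeries.order_mul h2 (hookPoly_ne_zero_and_order lam).1, order_zpow_of_ne_zero qVar_ne_zero,
    (hookPoly_ne_zero_and_order lam).2, order_qVar, order_prod_of_ne_zero _ _ h5,
    Finset.sum_congr rfl fun i _ => order_hallPairing_eq lam (μ i)]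
  ring

/-- The prefactor `q^{(1-g)n}` is absorbed by completing `2m_i` and `2n(λ)` with `n`, because `k -
(2g - 2 + k) = 2 - 2g`. -/
theorem two_mul_valuationA : 2 * (valuationA g μ lam : ℚ) =
    ∑ i, (2 * (pairingOrder lam (μ i) : ℚ) + n) -
      (2 * (g : ℚ) - 2 + k) * (2 * nStat lam + n) := by
  rw [valuationA_eq, Finset.sum_add_distrib, ← Finset.mul_sum]
  push_cast
  simp
  ring

theorem two_mul_valuationA_ones (hn : 0 < n) :
    2 * (valuationA g μ (ones n) : ℚ) = -2 * bigDelta g μ := by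
  rw [two_mul_valuationA, bigDelta]
  have h1 : (2 * nStat (ones n) + n : ℚ) = n ^ 2 := by exact_mod_cast two_mul_nStat_ones_add n
  have h2 : ∀ i, (2 * (pairingOrder (ones n) (μ i) : ℚ) + n) =
      ∑ p ∈ range (rows (μ i)).length, (part (μ i) p : ℚ) ^ 2 := fun i => by
    exact_mod_cast two_mul_order_ones hn (isWeight_pairingOrder _ _) (pairingOrder_le _ _)
  rw [h1, Finset.sum_congr rfl fun i _ => h2 i]
  ring

theorem rows_length_eq_zero (ν : Nat.Partition 0) : (rows ν).length = 0 := by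
  by_contra h
  have h1 := (part_pos_iff ν).2 (Nat.pos_of_ne_zero h)
  have h2 := Finset.single_le_sum (f := fun p => part ν p) (fun _ _ => Nat.zero_le _)
    (mem_range.2 (Nat.pos_of_ne_zero h))
  rw [sum_part] at h2
  omega

theorem valuationA_ones_eq : (valuationA g μ (ones n) : ℚ) = -bigDelta g μ := by
  rcases Nat.eq_zero_or_pos n with rfl | hn
  · have h : ∀ i, pairingOrder (ones 0) (μ i) = 0 := by
      intro i
      have := pairingOrder_le _ _ _ (isWeight_of_union (ones 0) (μ i) (fun p => ones _)
        (sum_parts_ones (μ i)))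
      rw [rows_length_eq_zero] at this
      simpa using this
    have hN : nStat (ones 0) = 0 := by
      have := two_mul_nStat_ones_add 0
      omega
    rw [valuationA_eq, bigDelta]
    simp [h, hN, rows_length_eq_zero]
  · have := two_mul_valuationA_ones g μ hn
    linarith

/-- The excess of `v(λ)` over `v((1^n))`. -/
theorem valuationA_sub (hn : 0 < n) :
    2 * (n : ℚ) * (valuationA g μ lam - valuationA g μ (ones n)) =
      smallDelta g μ * ((n : ℚ) ^ 2 - (2 * nStat lam + n)) +
        ∑ i, gap lam (μ i) (pairingOrder lam (μ i)) := by
  have h1 := two_mul_valuationA g μ lam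
  have h2 := two_mul_valuationA_ones g μ hn
  have h3 : ∑ i, gap lam (μ i) (pairingOrder lam (μ i)) =
      (∑ i, (part (μ i) 0 : ℚ)) * ((n : ℚ) ^ 2 - (2 * nStat lam + n)) -
      n * (∑ i, ∑ p ∈ range (rows (μ i)).length, (part (μ i) p : ℚ) ^ 2 -
        ∑ i, (2 * (pairingOrder lam (μ i) : ℚ) + n)) := by
    simp only [gap]
    rw [Finset.sum_sub_distrib, ← Finset.mul_sum, Finset.sum_sub_distrib, Finset.sum_mul]
  have h4 : 2 * (n : ℚ) * (valuationA g μ lam - valuationA g μ (ones n)) =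
      n * (2 * (valuationA g μ lam : ℚ) - 2 * valuationA g μ (ones n)) := by ring
  rw [h4, h1, h2, h3, smallDelta, bigDelta]
  push_cast
  ring

theorem two_mul_nStat_add_le : (2 * nStat lam + n : ℚ) ≤ (n : ℚ) ^ 2 := by
  have h : (2 * nStat lam + n : ℚ) = ∑ s ∈ range n, ((diagram lam).colLen s : ℚ) ^ 2 := by
    exact_mod_cast two_mul_nStat_add lam
  have h2 : (n : ℚ) = ∑ s ∈ range n, ((diagram lam).colLen s : ℚ) := by
    exact_mod_cast (sum_colLen_diagram lam).symm
  rw [h]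
  conv_rhs => rw [h2]
  exact sum_sq_le_sq_sum fun s _ => Nat.cast_nonneg _

theorem gap_pairingOrder_nonneg (hn : 0 < n) (ν : n.Partition) :
    0 ≤ gap lam ν (pairingOrder lam ν) := (gap_nonneg_and_eq_zero hn (isWeight_pairingOrder lam ν)).1

theorem valuationA_ones_le (hδ : 0 ≤ smallDelta g μ) :
    valuationA g μ (ones n) ≤ valuationA g μ lam := by
  rcases Nat.eq_zero_or_pos n with rfl | hn
  · rw [Subsingleton.elim lam (ones 0)]
  have h := valuationA_sub g μ lam hn
  have h1 : 0 ≤ (smallDelta g μ : ℚ) * ((n : ℚ) ^ 2 - (2 * nStat lam + n)) :=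
    mul_nonneg (by exact_mod_cast hδ) (sub_nonneg.2 (two_mul_nStat_add_le lam))
  have h2 : 0 ≤ ∑ i, gap lam (μ i) (pairingOrder lam (μ i)) :=
    Finset.sum_nonneg fun i _ => gap_pairingOrder_nonneg lam hn (μ i)
  have hn0 : (0 : ℚ) < 2 * n := by positivity
  have h3 := nonneg_of_mul_nonneg_right (h ▸ add_nonneg h1 h2) hn0
  have h4 : (valuationA g μ (ones n) : ℚ) ≤ valuationA g μ lam := by linarith
  exact_mod_cast h4

/-! ### Partitions at which the minimum is reached -/

theorem isMin_iff (hδ : 0 ≤ smallDelta g μ) :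
    (∀ κ : n.Partition, valuationA g μ lam ≤ valuationA g μ κ) ↔
      valuationA g μ lam = valuationA g μ (ones n) :=
  ⟨fun h => le_antisymm (h _) (valuationA_ones_le g μ lam hδ),
    fun h κ => h.trans_le (valuationA_ones_le g μ κ hδ)⟩

/-- All parts of every `μ^i` are equal. -/
def Rectangular (μ : Fin k → n.Partition) : Prop :=
  ∀ i, ∀ p < (rows (μ i)).length, part (μ i) p = part (μ i) 0

/-- The least common multiple of the lengths of the `μ^i`. -/
def lcmLength (μ : Fin k → n.Partition) : ℕ :=
  (univ : Finset (Fin k)).lcm fun i => (rows (μ i)).length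

/-- All summands of `valuationA_sub` are nonnegative, so all vanish. For `λ ≠ (1^n)` the factor `n²
- N(λ)` is nonzero, which forces `δ = 0`, and every gap is in its nontrivial equality case. -/
theorem rectangular_of_isMin (hn : 0 < n) (hδ : 0 ≤ smallDelta g μ)
    (h : valuationA g μ lam = valuationA g μ (ones n)) (hne : lam ≠ ones n) :
    smallDelta g μ = 0 ∧ Rectangular μ ∧ ∀ s, lcmLength μ ∣ (diagram lam).colLen s := by
  have hs := valuationA_sub g μ lam hn
  rw [h, sub_self, mul_zero] at hs
  have h1 : 0 ≤ (smallDelta g μ : ℚ) * ((n : ℚ) ^ 2 - (2 * nStat lam + n)) :=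
    mul_nonneg (by exact_mod_cast hδ) (sub_nonneg.2 (two_mul_nStat_add_le lam))
  have hg : ∀ i ∈ univ, 0 ≤ gap lam (μ i) (pairingOrder lam (μ i)) :=
    fun i _ => gap_pairingOrder_nonneg lam hn (μ i)
  have h2 := Finset.sum_nonneg hg
  have h3 : (smallDelta g μ : ℚ) * ((n : ℚ) ^ 2 - (2 * nStat lam + n)) = 0 := by linarith
  have h4 : ∑ i, gap lam (μ i) (pairingOrder lam (μ i)) = 0 := by linarith
  have hN : (n : ℚ) ^ 2 - (2 * nStat lam + n) ≠ 0 := fun h0 =>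
    hne (eq_ones_of_nStat lam (by exact_mod_cast (sub_eq_zero.1 h0).symm))
  have h5 : ∀ i, _ := fun i => ((gap_nonneg_and_eq_zero hn (isWeight_pairingOrder lam (μ i))).2
    ((Finset.sum_eq_zero_iff_of_nonneg hg).1 h4 i (mem_univ i))).resolve_left hne
  refine ⟨by exact_mod_cast (mul_eq_zero.1 h3).resolve_right hN, fun i => (h5 i).1, fun s => ?_⟩
  exact Finset.lcm_dvd fun i _ => (h5 i).2 s

theorem length_mul_part (hrect : Rectangular μ) (i : Fin k) :
    (rows (μ i)).length * part (μ i) 0 = n := by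
  have h := sum_part (μ i)
  rw [Finset.sum_congr rfl fun p hp => hrect i p (mem_range.1 hp)] at h
  simpa using h

theorem lcmLength_dvd (hrect : Rectangular μ) : lcmLength μ ∣ n :=
  Finset.lcm_dvd fun i _ => Dvd.intro _ (length_mul_part μ hrect i)

/-- With `L = ℓ_i e`, the `L` copies of `λ₀` are `ℓ_i` copies of the union of `e` copies, a
partition of `μ^i_1`; so each gap vanishes separately. -/
theorem valuationA_eq_of_copies (hn : 0 < n) (hδ : smallDelta g μ = 0) (hrect : Rectangular μ)
    {t : ℕ} (lam₀ : t.Partition) (h : lam.parts = lcmLength μ • lam₀.parts) :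
    valuationA g μ lam = valuationA g μ (ones n) := by
  have hs := valuationA_sub g μ lam hn
  have h0 : ∀ i ∈ univ, gap lam (μ i) (pairingOrder lam (μ i)) = 0 := by
    intro i _
    obtain ⟨e, he⟩ : (rows (μ i)).length ∣ lcmLength μ := Finset.dvd_lcm (mem_univ i)
    have hl := length_pos hn (μ i)
    have hsum : (e • lam₀.parts).sum = part (μ i) 0 := by
      have h1 := congrArg Multiset.sum h
      rw [lam.parts_sum, he, mul_smul, Multiset.sum_nsmul, smul_eq_mul] at h1
      exact Nat.eq_of_mul_eq_mul_left hl (h1.symm.trans (length_mul_part μ hrect i).symm)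
    refine gap_eq_zero_of_copies hn (isWeight_pairingOrder _ _) (pairingOrder_le _ _) (hrect i)
      ⟨e • lam₀.parts, fun ha => lam₀.parts_pos (Multiset.mem_of_mem_nsmul ha), hsum⟩ ?_
    rw [h, he, mul_smul]
  rw [hδ, Finset.sum_eq_zero h0] at hs
  have hn0 : (2 * n : ℚ) ≠ 0 := by positivity
  have := (mul_eq_zero.1 (hs.trans (by simp))).resolve_left hn0
  have h2 : (valuationA g μ lam : ℚ) = valuationA g μ (ones n) := by linarith
  exact_mod_cast h2

theorem exists_copies {L t : ℕ} (hL : 0 < L) (hLt : n = L * t)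
    (h : ∀ s, L ∣ (diagram lam).colLen s) : ∃ lam₀ : t.Partition, lam.parts = L • lam₀.parts := by
  have hc : ∀ a ∈ lam.parts, L ∣ lam.parts.count a := by
    intro a ha
    obtain ⟨r, rfl⟩ := Nat.exists_eq_succ_of_ne_zero (lam.parts_pos ha).ne'
    have := count_parts lam r
    exact (Nat.dvd_add_left (h (r + 1))).1 (this ▸ h r)
  obtain ⟨u, hu⟩ : ∃ u, lam.parts = L • u := Multiset.exists_smul_of_dvd_count _ hc
  have hsum := lam.parts_sum
  rw [hu, Multiset.sum_nsmul, smul_eq_mul, hLt] at hsum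
  refine ⟨⟨u, fun {a} ha => lam.parts_pos ?_, Nat.eq_of_mul_eq_mul_left hL hsum⟩, hu⟩
  rw [hu]
  exact (Multiset.mem_nsmul_of_ne_zero hL.ne').2 ha

/-- In the rectangular case with `δ = 0` the minimum is reached exactly at the unions of
`lcm(l(μ^i))` copies of a partition. -/
theorem isMin_iff_copies (hn : 0 < n) (hδ : smallDelta g μ = 0) (hrect : Rectangular μ) {t : ℕ}
    (ht : n = lcmLength μ * t) : valuationA g μ lam = valuationA g μ (ones n) ↔
      ∃ lam₀ : t.Partition, lam.parts = lcmLength μ • lam₀.parts := by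
  constructor
  · intro h
    by_cases hne : lam = ones n
    · refine ⟨ones t, ?_⟩
      rw [hne, parts_ones, parts_ones, Multiset.nsmul_replicate, ← ht]
    · refine exists_copies lam ?_ ht (rectangular_of_isMin g μ lam hn hδ.ge h hne).2.2
      exact Nat.pos_of_dvd_of_pos (lcmLength_dvd μ hrect) hn
  · rintro ⟨lam₀, h⟩
    exact valuationA_eq_of_copies g μ lam hn hδ hrect lam₀ h

end SymFun

/-! ### Tits forms and imaginary roots of quivers -/

namespace FinQuiver

open Finset

variable {I : Type} [DecidableEq I] (Q : FinQuiver I)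

attribute [instance] FinQuiver.fintypeArrow

/-- Counting arrows by direction treats diagonal and off-diagonal entries alike: a loop is counted
once by `numEdges` but belongs to both sets here, which accounts for the factor 2. -/
theorem cartan_apply (i j : I) : Q.cartan i j = (if i = j then 2 else 0) -
    (#{a : Q.Arrow | Q.tail a = i ∧ Q.head a = j} : ℤ) -
    (#{a : Q.Arrow | Q.tail a = j ∧ Q.head a = i} : ℤ) := by
  classical
  have h : Q.numEdges i j = #{a : Q.Arrow | (Q.tail a = i ∧ Q.head a = j) ∨
      (Q.tail a = j ∧ Q.head a = i)} := by
    rw [numEdges, Nat.card_eq_fintype_card, Fintype.card_subtype]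
  unfold cartan
  split_ifs with hij
  · subst hij
    rw [h]
    simp only [or_self]
    ring
  · rw [h, Finset.filter_or, Finset.card_union_of_disjoint]
    · push_cast; ring
    · rw [Finset.disjoint_filter]
      rintro a _ ⟨h1, _⟩ ⟨h2, _⟩
      exact hij (h1.symm.trans h2)

theorem cartan_comm (i j : I) : Q.cartan i j = Q.cartan j i := by
  rw [cartan_apply, cartan_apply]
  simp only [eq_comm (a := i) (b := j)]
  ring

theorem cartan_nonpos {i j : I} (h : i ≠ j) : Q.cartan i j ≤ 0 := by
  rw [cartan_apply, if_neg h]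
  have h1 := Nat.cast_nonneg (α := ℤ) #{a : Q.Arrow | Q.tail a = i ∧ Q.head a = j}
  have h2 := Nat.cast_nonneg (α := ℤ) #{a : Q.Arrow | Q.tail a = j ∧ Q.head a = i}
  linarith

theorem cartan_self_le (i : I) : Q.cartan i i ≤ 2 := by
  rw [cartan_apply, if_pos rfl]
  have h1 := Nat.cast_nonneg (α := ℤ) #{a : Q.Arrow | Q.tail a = i ∧ Q.head a = i}
  linarith

variable [Fintype I]

theorem cartan_mulVec (u : I → ℤ) (i : I) : Q.cartan.mulVec u i = 2 * u i -
    (∑ a : Q.Arrow, if Q.tail a = i then u (Q.head a) else 0) -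
    ∑ a : Q.Arrow, if Q.head a = i then u (Q.tail a) else 0 := by
  have h1 : ∀ f f' : Q.Arrow → I, ∑ j, (#{a : Q.Arrow | f a = i ∧ f' a = j} : ℤ) * u j =
      ∑ a : Q.Arrow, if f a = i then u (f' a) else 0 := by
    intro f f'
    simp_rw [Finset.card_filter, Nat.cast_sum, Finset.sum_mul]
    rw [Finset.sum_comm]
    refine Finset.sum_congr rfl fun a _ => ?_
    rw [Finset.sum_eq_single (f' a)]
    · split_ifs <;> simp_all
    · intro j _ hj
      simp [hj.symm]
    · simp
  have h2 : ∀ j, #{a : Q.Arrow | Q.tail a = j ∧ Q.head a = i} =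
      #{a : Q.Arrow | Q.head a = i ∧ Q.tail a = j} := fun j => by simp only [and_comm]
  simp only [Matrix.mulVec, dotProduct, cartan_apply, h2, sub_mul, Finset.sum_sub_distrib]
  rw [h1, h1]
  simp

/-- The coefficient 2 matters: if the form is nonpositive at `u` and `(Cu)_i ≤ -1`, the value at `2u
+ e_i` is at most `-4 + 2 < 0`, whereas `u + e_i` would only give a bound of `0`. -/
theorem titsForm_two_nsmul_add_single (u : I → ℤ) (i : I) :
    Q.titsForm (2 • u + Pi.single i 1) =
      4 * Q.titsForm u + 4 * Q.cartan.mulVec u i + Q.cartan i i := by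
  have hs : ∀ x y : I → ℤ, x ⬝ᵥ Q.cartan.mulVec y = y ⬝ᵥ Q.cartan.mulVec x := by
    intro x y
    simp only [Matrix.mulVec, dotProduct, Finset.mul_sum]
    rw [Finset.sum_comm]
    refine Finset.sum_congr rfl fun j _ => Finset.sum_congr rfl fun l _ => ?_
    rw [Q.cartan_comm j l]; ring
  have h1 : Pi.single i 1 ⬝ᵥ Q.cartan.mulVec u = Q.cartan.mulVec u i := by
    rw [single_dotProduct, one_mul]
  have h2 : Pi.single i 1 ⬝ᵥ Q.cartan.mulVec (Pi.single i 1) = Q.cartan i i := by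
    rw [single_dotProduct, one_mul, Matrix.mulVec_single_one]
    rfl
  rw [titsForm, titsForm, Matrix.mulVec_add, add_dotProduct, dotProduct_add, dotProduct_add,
    Matrix.mulVec_smul, smul_dotProduct, smul_dotProduct, dotProduct_smul, dotProduct_smul,
    hs u (Pi.single i 1), h1, h2]
  simp only [nsmul_eq_mul]
  push_cast
  ring

variable {Q}

theorem IsFundamental.mulVec_eq_zero (hQ : ∀ x, 0 ≤ Q.titsForm x) {u : I → ℤ}
    (hu : Q.IsFundamental u) : Q.cartan.mulVec u = 0 := by
  have h0 : Q.titsForm u ≤ 0 := Finset.sum_nonpos fun i _ =>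
    mul_nonpos_of_nonneg_of_nonpos (hu.1 i) (hu.2.2.2 i)
  funext i
  refine le_antisymm (hu.2.2.2 i) ?_
  have h1 := hQ (2 • u + Pi.single i 1)
  rw [titsForm_two_nsmul_add_single] at h1
  have h2 := Q.cartan_self_le i
  change 0 ≤ Q.cartan.mulVec u i
  omega

/-- If the Tits form is positive semidefinite, every imaginary root lies in its radical, and it is
fundamental. -/
theorem IsPosImaginaryRoot.isFundamental (hQ : ∀ x, 0 ≤ Q.titsForm x) {u : I → ℤ}
    (hu : Q.IsPosImaginaryRoot u) : Q.IsFundamental u := by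
  induction hu with
  | fundamental u hu => exact hu
  | reflection i hi u _ ih =>
    have : Q.reflect i u = u := by
      rw [reflect, ih.mulVec_eq_zero hQ]
      simp
    rwa [this]

/-- A positive vector in the radical makes the Tits form positive semidefinite. -/
theorem titsForm_nonneg_of_pos {v : I → ℤ} (hv : ∀ i, 0 < v i) (hCv : Q.cartan.mulVec v = 0)
    (x : I → ℤ) : 0 ≤ Q.titsForm x := by
  have hv' : ∀ i, (0 : ℚ) < v i := fun i => by exact_mod_cast hv i
  have hrow : ∀ i, ∑ j, (Q.cartan i j : ℚ) * v j = 0 := fun i => by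
    have := congrFun hCv i
    simp only [Matrix.mulVec, dotProduct, Pi.zero_apply] at this
    exact_mod_cast this
  -- Off the diagonal this is `(x_i v_j - x_j v_i)² ≥ 0` divided by `v_i v_j` and multiplied by a
  -- nonpositive Cartan entry. After summation both terms on the left vanish because `C v = 0`.
  have key : ∀ i j, (1 / 2 : ℚ) * (Q.cartan i j * ((x i : ℚ) ^ 2 * v j / v i)) +
      (1 / 2) * (Q.cartan i j * ((x j : ℚ) ^ 2 * v i / v j)) ≤ x i * (Q.cartan i j * x j) := by
    intro i j
    have hi := hv' i
    have hj := hv' j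
    by_cases h : i = j
    · subst h
      refine le_of_eq ?_
      field_simp
      ring
    · have hc : (Q.cartan i j : ℚ) ≤ 0 := by exact_mod_cast Q.cartan_nonpos h
      have hsq : 0 ≤ ((x i : ℚ) * v j - x j * v i) ^ 2 / (v i * v j) := by positivity
      have he : ((x i : ℚ) * v j - x j * v i) ^ 2 / (v i * v j) =
          (x i : ℚ) ^ 2 * v j / v i + (x j : ℚ) ^ 2 * v i / v j - 2 * (x i * x j) := by
        field_simp
        ring
      rw [he] at hsq
      have := mul_nonneg_of_nonpos_of_nonpos hc (neg_nonpos.2 hsq)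
      linarith
  have hsum := Finset.sum_le_sum fun i (_ : i ∈ univ) => Finset.sum_le_sum fun j
    (_ : j ∈ univ) => key i j
  have hz : ∀ i, ∑ j, (Q.cartan i j * ((x i : ℚ) ^ 2 * v j / v i)) = 0 := by
    intro i
    have : ∀ j, (Q.cartan i j * ((x i : ℚ) ^ 2 * v j / v i)) =
        (x i : ℚ) ^ 2 / v i * (Q.cartan i j * v j) := fun j => by ring
    rw [Finset.sum_congr rfl fun j _ => this j, ← Finset.mul_sum, hrow, mul_zero]
  have hz' : ∑ i, ∑ j, (Q.cartan i j * ((x j : ℚ) ^ 2 * v i / v j)) = 0 := by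
    rw [Finset.sum_comm]
    refine Finset.sum_eq_zero fun j _ => ?_
    rw [← hz j]
    exact Finset.sum_congr rfl fun i _ => by rw [Q.cartan_comm]
  simp only [Finset.sum_add_distrib, ← Finset.mul_sum] at hsum
  rw [hz', Finset.sum_eq_zero fun i _ => hz i] at hsum
  have : (0 : ℚ) ≤ ∑ i, x i * ∑ j, (Q.cartan i j * (x j : ℚ)) := by simpa using hsum
  have h2 : (0 : ℤ) ≤ ∑ i, x i * ∑ j, (Q.cartan i j * x j) := by exact_mod_cast this
  exact h2

theorem isFundamental_of_pos {w : I → ℤ} (hc : Q.graph.Connected) (hw : ∀ i, 0 < w i)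
    (hCw : Q.cartan.mulVec w = 0) : Q.IsFundamental w := by
  have hne : {i | w i ≠ 0} = Set.univ := by
    ext i
    simp [(hw i).ne']
  refine ⟨fun i => (hw i).le, ?_, ?_, fun i => by rw [hCw]; exact le_rfl⟩
  · obtain ⟨i⟩ := hc.nonempty
    exact fun h => (hw i).ne' (congrFun h i)
  · rw [hne]
    exact (SimpleGraph.induceUnivIso Q.graph).connected_iff.2 hc

end FinQuiver

namespace SymFun

open Finset

/-! ### The comet-shaped quiver -/

variable {n k : ℕ} (g : ℕ) (μ : Fin k → n.Partition)

/-- The values of `u` along the `i`-th leg, starting with the central vertex and continued by `0`. -/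
def legValue {μ : Fin k → n.Partition} (u : CometVertex μ → ℤ) (i : Fin k) : ℕ → ℤ
  | 0 => u none
  | j + 1 => if h : j < (rows (μ i)).length - 1 then u (some ⟨i, ⟨j, h⟩⟩) else 0

variable {μ}

theorem legValue_succ (u : CometVertex μ → ℤ) (p : Leg μ) :
    legValue u p.1 (p.2 + 1) = u (some p) := by
  obtain ⟨i, j, hj⟩ := p
  simp [legValue, hj]

theorem apply_head (u : CometVertex μ → ℤ) (p : Leg μ) :
    u ((cometQuiver g μ).head (Sum.inr p)) = legValue u p.1 p.2 := by
  obtain ⟨i, j, hj⟩ := p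
  rcases j with _ | j
  · rfl
  · have : j < (rows (μ i)).length - 1 := by omega
    simp only [legValue, this, dif_pos]
    rfl

theorem head_eq_some_iff (p q : Leg μ) : (cometQuiver g μ).head (Sum.inr p) = some q ↔
    p.1 = q.1 ∧ (p.2 : ℕ) = q.2 + 1 := by
  obtain ⟨i, j, hj⟩ := p
  obtain ⟨i', j', hj'⟩ := q
  rcases j with _ | j
  · simp [cometQuiver]
  · simp only [cometQuiver, Option.some.injEq, Sigma.mk.injEq]
    constructor
    · rintro ⟨rfl, h⟩
      have := congrArg Fin.val (eq_of_heq h)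
      simpa using this
    · rintro ⟨h, h2⟩
      subst h
      have : j = j' := by omega
      subst this
      exact ⟨rfl, HEq.rfl⟩

theorem head_eq_none_iff (p : Leg μ) : (cometQuiver g μ).head (Sum.inr p) = none ↔
    (p.2 : ℕ) = 0 := by
  obtain ⟨i, j, hj⟩ := p
  rcases j with _ | j <;> simp [cometQuiver]

/-- Minus the second difference along the leg. Starting `legValue` at the centre and continuing it
by `0` removes the exceptions at the two ends. -/
theorem cartan_mulVec_some (u : CometVertex μ → ℤ) (p : Leg μ) :
    (cometQuiver g μ).cartan.mulVec u (some p) =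
      2 * legValue u p.1 (p.2 + 1) - legValue u p.1 p.2 - legValue u p.1 (p.2 + 2) := by
  rw [FinQuiver.cartan_mulVec, legValue_succ]
  congr 1
  · congr 1
    have h := Fintype.sum_sum_type (fun a : Fin g ⊕ Leg μ =>
      if (cometQuiver g μ).tail a = some p then u ((cometQuiver g μ).head a) else 0)
    refine Eq.trans h ?_
    rw [Finset.sum_eq_zero (fun a _ => by simp [cometQuiver]), zero_add,
      Finset.sum_eq_single p]
    · exact (if_pos rfl).trans (apply_head g u p)
    · intro q _ hq
      simp [cometQuiver, hq]
    · simp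
  · have h := Fintype.sum_sum_type (fun a : Fin g ⊕ Leg μ =>
      if (cometQuiver g μ).head a = some p then u ((cometQuiver g μ).tail a) else 0)
    refine Eq.trans h ?_
    rw [Finset.sum_eq_zero (fun a _ => by simp [cometQuiver]), zero_add]
    simp only [head_eq_some_iff]
    obtain ⟨i, j, hj⟩ := p
    by_cases hj' : j + 1 < (rows (μ i)).length - 1
    · rw [Finset.sum_eq_single (⟨i, ⟨j + 1, hj'⟩⟩ : Leg μ)]
      · simp [legValue, hj', cometQuiver]
      · rintro ⟨i', j', h'⟩ _ hne
        rw [if_neg]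
        rintro ⟨h1, h2⟩
        simp only at h1 h2
        subst h1
        subst h2
        exact hne rfl
      · simp
    · rw [Finset.sum_eq_zero]
      · simp [legValue, hj']
      · rintro ⟨i', j', h'⟩ _
        rw [if_neg]
        rintro ⟨h1, h2⟩
        simp only at h1 h2
        subst h1
        omega

/-- Each loop contributes once through its head and once through its tail; a leg without vertices
contributes `legValue u i 1 = 0`. -/
theorem cartan_mulVec_none (u : CometVertex μ → ℤ) :
    (cometQuiver g μ).cartan.mulVec u none =
      (2 - 2 * g) * u none - ∑ i, legValue u i 1 := by
  rw [FinQuiver.cartan_mulVec]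
  have h1 : (∑ a : (cometQuiver g μ).Arrow, if (cometQuiver g μ).tail a = none then
      u ((cometQuiver g μ).head a) else 0) = g * u none := by
    have h := Fintype.sum_sum_type (fun a : Fin g ⊕ Leg μ =>
      if (cometQuiver g μ).tail a = none then u ((cometQuiver g μ).head a) else 0)
    refine Eq.trans h ?_
    simp [cometQuiver]
  have h2 : (∑ a : (cometQuiver g μ).Arrow, if (cometQuiver g μ).head a = none then
      u ((cometQuiver g μ).tail a) else 0) = g * u none + ∑ i, legValue u i 1 := by
    have h := Fintype.sum_sum_type (fun a : Fin g ⊕ Leg μ =>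
      if (cometQuiver g μ).head a = none then u ((cometQuiver g μ).tail a) else 0)
    refine Eq.trans h ?_
    congr 1
    · simp [cometQuiver]
    · simp only [head_eq_none_iff]
      rw [Fintype.sum_sigma]
      refine Finset.sum_congr rfl fun i _ => ?_
      by_cases hi : 0 < (rows (μ i)).length - 1
      · rw [Finset.sum_eq_single ⟨0, hi⟩]
        · simp [legValue, hi, cometQuiver]
        · intro j _ hj
          rw [if_neg]
          exact fun h => hj (Fin.ext h)
        · simp
      · simp only [legValue, hi, dif_neg, not_false_eq_true]
        refine Finset.sum_eq_zero fun j _ => ?_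
        have := j.2
        omega
  rw [h1, h2]
  ring

theorem comet_connected : (cometQuiver g μ).graph.Connected := by
  have hr : ∀ (i : Fin k) (j : ℕ) (hj : j < (rows (μ i)).length - 1),
      (cometQuiver g μ).graph.Reachable none (some ⟨i, ⟨j, hj⟩⟩) := by
    intro i j
    induction j with
    | zero =>
      intro hj
      refine SimpleGraph.Adj.reachable ?_
      rw [FinQuiver.graph, SimpleGraph.fromRel_adj]
      exact ⟨by simp, Or.inr ⟨Sum.inr ⟨i, ⟨0, hj⟩⟩, rfl, rfl⟩⟩
    | succ j ih =>
      intro hj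
      refine (ih (by omega)).trans (SimpleGraph.Adj.reachable ?_)
      rw [FinQuiver.graph, SimpleGraph.fromRel_adj]
      exact ⟨by simp, Or.inr ⟨Sum.inr ⟨i, ⟨j + 1, hj⟩⟩, rfl, rfl⟩⟩
  rw [SimpleGraph.connected_iff_exists_forall_reachable]
  refine ⟨none, fun x => ?_⟩
  rcases x with _ | ⟨i, j, hj⟩
  · exact SimpleGraph.Reachable.refl _
  · exact hr i j hj

/-! ### The dimension vector and the radical of the Tits form -/

theorem sum_range_part_of_le (ν : n.Partition) {j : ℕ} (hj : (rows ν).length ≤ j) :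
    ∑ r ∈ range j, (part ν r : ℤ) = n := by
  have h := sum_part ν
  rw [Finset.sum_subset (Finset.range_subset_range.2 hj) fun r _ hr =>
    part_of_le ν (by simpa using hr)] at h
  exact_mod_cast h

theorem legValue_dimVector (hn : 0 < n) (i : Fin k) (j : ℕ) :
    legValue (dimVector μ) i j = n - ∑ r ∈ range j, (part (μ i) r : ℤ) := by
  have hl := length_pos hn (μ i)
  rcases j with _ | j
  · simp [legValue, dimVector]
  · by_cases hj : j < (rows (μ i)).length - 1
    · simp [legValue, hj, dimVector]
    · rw [sum_range_part_of_le (μ i) (by omega)]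
      simp [legValue, hj]

theorem cartan_mulVec_dimVector_none (hn : 0 < n) :
    (cometQuiver g μ).cartan.mulVec (dimVector μ) none = -smallDelta g μ := by
  rw [cartan_mulVec_none]
  simp only [legValue_dimVector hn]
  simp [dimVector, smallDelta]
  ring

theorem cartan_mulVec_dimVector_some (hn : 0 < n) (p : Leg μ) :
    (cometQuiver g μ).cartan.mulVec (dimVector μ) (some p) =
      part (μ p.1) (p.2 + 1) - part (μ p.1) p.2 := by
  rw [cartan_mulVec_some]
  simp only [legValue_dimVector hn, Finset.sum_range_succ]
  ring

theorem dimVector_pos (hn : 0 < n) (x : CometVertex μ) : 0 < dimVector μ x := by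
  rcases x with _ | ⟨i, j, hj⟩
  · simpa [dimVector] using hn
  · have h : ∑ r ∈ range (j + 1), part (μ i) r < n := by
      conv_rhs => rw [← sum_part (μ i)]
      refine Finset.sum_lt_sum_of_subset (i := j + 1) (Finset.range_subset_range.2 (by omega))
        (mem_range.2 (by omega)) (by simp) ((part_pos_iff _).2 (by omega)) fun _ _ _ => Nat.zero_le _
    have h' : ∑ r ∈ range (j + 1), (part (μ i) r : ℤ) < n := by exact_mod_cast h
    simp only [dimVector]
    linarith

/-- The entries of `C 𝐯` are `-δ` at the centre and the differences of consecutive parts on the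
legs. -/
theorem dimVector_radical_iff (hn : 0 < n) :
    (cometQuiver g μ).cartan.mulVec (dimVector μ) = 0 ↔ smallDelta g μ = 0 ∧ Rectangular μ := by
  constructor
  · intro h
    refine ⟨?_, fun i p => ?_⟩
    · have := congrFun h none
      rw [cartan_mulVec_dimVector_none g hn, Pi.zero_apply] at this
      linarith
    · induction p with
      | zero => simp
      | succ p ih =>
        intro hp
        have := congrFun h (some ⟨i, ⟨p, by omega⟩⟩)
        rw [cartan_mulVec_dimVector_some g hn, Pi.zero_apply] at this
        simp only at this
        have h2 := ih (by omega)
        omega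
  · rintro ⟨hδ, hrect⟩
    funext x
    rcases x with _ | ⟨i, j, hj⟩
    · rw [cartan_mulVec_dimVector_none g hn, hδ]; rfl
    · rw [cartan_mulVec_dimVector_some g hn]
      simp only [Pi.zero_apply]
      rw [hrect i (j + 1) (by omega), hrect i j (by omega), sub_self]

/-- A vector in the radical is linear along the legs. -/
theorem legValue_of_radical {u : CometVertex μ → ℤ} (hu : (cometQuiver g μ).cartan.mulVec u = 0)
    (i : Fin k) {j : ℕ} (hj : j ≤ (rows (μ i)).length) :
    legValue u i j = u none - j * (u none - legValue u i 1) := by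
  -- The recurrence is of second order, so two consecutive values are carried through the induction.
  have h : ∀ j, (j ≤ (rows (μ i)).length → legValue u i j = u none - j * (u none - legValue u i 1)) ∧
      (j + 1 ≤ (rows (μ i)).length →
        legValue u i (j + 1) = u none - (j + 1) * (u none - legValue u i 1)) := by
    intro j
    induction j with
    | zero => exact ⟨fun _ => by simp [legValue], fun _ => by simp⟩
    | succ j ih =>
      refine ⟨fun h => by rw [ih.2 h]; push_cast; ring, fun h => ?_⟩
      have h1 := congrFun hu (some ⟨i, ⟨j, by omega⟩⟩)
      rw [cartan_mulVec_some] at h1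
      simp only [Pi.zero_apply] at h1
      rw [ih.1 (by omega), ih.2 (by omega)] at h1
      push_cast
      linarith
  exact (h j).1 hj

/-- Linearity along the leg is evaluated at position `l(μ^i)`, just past its last vertex, where the
value is `0`. So `l(μ^i)` divides the central value. -/
theorem apply_none_of_radical (hn : 0 < n) {u : CometVertex μ → ℤ}
    (hu : (cometQuiver g μ).cartan.mulVec u = 0) (i : Fin k) :
    u none = (rows (μ i)).length * (u none - legValue u i 1) := by
  have h := legValue_of_radical g hu i le_rfl
  have hl := length_pos hn (μ i)
  obtain ⟨l, hl'⟩ := Nat.exists_eq_succ_of_ne_zero hl.ne'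
  have h0 : legValue u i (rows (μ i)).length = 0 := by
    rw [hl']
    simp [legValue, hl']
  rw [h0] at h
  linarith

theorem lcmLength_dvd_of_radical (hn : 0 < n) {u : CometVertex μ → ℤ}
    (hu : (cometQuiver g μ).cartan.mulVec u = 0) : (lcmLength μ : ℤ) ∣ u none := by
  rw [Int.natCast_dvd]
  refine Finset.lcm_dvd fun i _ => ?_
  rw [← Int.natCast_dvd]
  exact ⟨_, apply_none_of_radical g hn hu i⟩

/-- Vectors in the radical are determined by their central value. -/
theorem eq_of_radical (hn : 0 < n) {u w : CometVertex μ → ℤ}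
    (hu : (cometQuiver g μ).cartan.mulVec u = 0) (hw : (cometQuiver g μ).cartan.mulVec w = 0)
    {s : ℤ} (h : u none = s * w none) : u = s • w := by
  funext x
  rcases x with _ | p
  · exact h
  · have hl := length_pos hn (μ p.1)
    have hp := p.2.2
    have h1 := apply_none_of_radical g hn hu p.1
    have h2 := apply_none_of_radical g hn hw p.1
    have h3 : u none - legValue u p.1 1 = s * (w none - legValue w p.1 1) := by
      have : ((rows (μ p.1)).length : ℤ) ≠ 0 := by exact_mod_cast hl.ne'
      apply mul_left_cancel₀ this
      rw [← h1, h, h2]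
      conv_lhs => rw [h2]
      ring
    rw [Pi.smul_apply, smul_eq_mul, ← legValue_succ u p, ← legValue_succ w p,
      legValue_of_radical g hu p.1 (by omega), legValue_of_radical g hw p.1 (by omega), h3, h]
    ring

/-- The dimension vector divided by `n / lcm(l(μ^i))`. -/
theorem exists_primitive (hn : 0 < n) (hrect : Rectangular μ) : ∃ w : CometVertex μ → ℤ,
    dimVector μ = (n / lcmLength μ) • w ∧ w none = lcmLength μ := by
  obtain ⟨t, ht⟩ := lcmLength_dvd μ hrect
  have hL : 0 < lcmLength μ := Nat.pos_of_dvd_of_pos (lcmLength_dvd μ hrect) hn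
  have hdiv : n / lcmLength μ = t :=
    Nat.div_eq_of_eq_mul_right hL ht
  rw [hdiv]
  have hd : ∀ i, ∃ e : ℕ, lcmLength μ = (rows (μ i)).length * e :=
    fun i => Finset.dvd_lcm (mem_univ i)
  choose e he using hd
  refine ⟨fun x => match x with
    | none => lcmLength μ
    -- `e i = L / l(μ^i)` is the descent per step on leg `i`; the zero-based index `p.2` stands at
    -- distance `p.2 + 1` from the centre.
    | some p => lcmLength μ - (p.2 + 1 : ℕ) * e p.1, ?_, rfl⟩
  funext x
  rcases x with _ | ⟨i, j, hj⟩
  · simp only [dimVector, Pi.smul_apply, nsmul_eq_mul]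
    exact_mod_cast ht.trans (mul_comm _ _)
  · have hpart : part (μ i) 0 = t * e i := by
      have h1 := length_mul_part μ hrect i
      refine Nat.eq_of_mul_eq_mul_left (length_pos hn (μ i)) ?_
      refine h1.trans (ht.trans ?_)
      rw [he i]; ring
    have hs : ∑ r ∈ range (j + 1), (part (μ i) r : ℤ) = (j + 1) * (t * e i) := by
      rw [Finset.sum_congr rfl (g := fun _ => ((t * e i : ℕ) : ℤ))]
      · simp
      · intro r hr
        rw [mem_range] at hr
        rw [hrect i r (by omega), hpart]
    simp only [dimVector, Pi.smul_apply, nsmul_eq_mul]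
    rw [hs]
    have ht' : (n : ℤ) = lcmLength μ * t := by exact_mod_cast ht
    rw [ht']
    push_cast
    ring

theorem primitive_pos_radical (hn : 0 < n) (hδ : smallDelta g μ = 0) (hrect : Rectangular μ)
    {t : ℕ} {w : CometVertex μ → ℤ} (h : dimVector μ = t • w) :
    (∀ x, 0 < w x) ∧ (cometQuiver g μ).cartan.mulVec w = 0 := by
  have hC := (dimVector_radical_iff g hn).2 ⟨hδ, hrect⟩
  constructor
  · intro x
    have h1 := dimVector_pos hn x
    rw [h, Pi.smul_apply, nsmul_eq_mul] at h1
    exact pos_of_mul_pos_right h1 (Nat.cast_nonneg t)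
  · rw [h, Matrix.mulVec_smul] at hC
    have ht : t ≠ 0 := by
      rintro rfl
      have h1 := dimVector_pos (μ := μ) hn none
      rw [h] at h1
      simp at h1
    exact (smul_eq_zero.1 hC).resolve_left ht

/-- If `δ = 0` and all `μ^i` are rectangular, the quiver is affine and `𝐯` is a multiple of the basic
imaginary root. -/
theorem affine_of_rectangular (hn : 0 < n) (hδ : smallDelta g μ = 0) (hrect : Rectangular μ) :
    (cometQuiver g μ).IsAffine ∧ ∃ (vstar : CometVertex μ → ℤ) (t : ℕ),
      (cometQuiver g μ).IsBasicImaginaryRoot vstar ∧ 1 ≤ t ∧ dimVector μ = t • vstar := by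
  obtain ⟨w, hw, hw0⟩ := exists_primitive hn hrect
  obtain ⟨hpos, hC⟩ := primitive_pos_radical g hn hδ hrect hw
  have hL : 0 < lcmLength μ := Nat.pos_of_dvd_of_pos (lcmLength_dvd μ hrect) hn
  have hpsd := FinQuiver.titsForm_nonneg_of_pos hpos hC
  refine ⟨⟨comet_connected g, hpsd, w, fun h => (hpos none).ne' (congrFun h none), ?_⟩, w, _, ?_,
    Nat.div_pos (Nat.le_of_dvd hn (lcmLength_dvd μ hrect)) hL, hw⟩
  · rw [FinQuiver.titsForm, hC, dotProduct_zero]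
  · intro u
    constructor
    · intro hu
      have hf := hu.isFundamental hpsd
      have hCu := hf.mulVec_eq_zero hpsd
      -- An imaginary root is in the radical, so `L` divides its central value. As `w` has central
      -- value exactly `L`, the root is an integer multiple of `w`.
      obtain ⟨s, hs⟩ := lcmLength_dvd_of_radical g hn hCu
      have hus : u = s • w := eq_of_radical g hn hCu hC (by rw [hs, hw0, mul_comm])
      have hs0 : 0 ≤ s := by
        have := hf.1 none
        rw [hs] at this
        exact nonneg_of_mul_nonneg_right this (by exact_mod_cast hL)
      lift s to ℕ using hs0
      refine ⟨s, Nat.one_le_iff_ne_zero.2 ?_, by rw [hus, natCast_zsmul]⟩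
      rintro rfl
      exact hf.2.1 (by rw [hus]; simp)
    · rintro ⟨t, ht, rfl⟩
      refine .fundamental _ (FinQuiver.isFundamental_of_pos (comet_connected g) (fun x => ?_) ?_)
      · rw [Pi.smul_apply, nsmul_eq_mul]
        exact mul_pos (by exact_mod_cast ht) (hpos x)
      · rw [Matrix.mulVec_smul, hC, smul_zero]

/-- If the quiver is affine and `𝐯 = t 𝐯^*`, then `δ = 0`, all `μ^i` are rectangular and
`n / t = lcm(l(μ^i))`. -/
theorem rectangular_of_affine (hn : 0 < n) {vstar : CometVertex μ → ℤ} {t : ℕ}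
    (haff : (cometQuiver g μ).IsAffine) (hb : (cometQuiver g μ).IsBasicImaginaryRoot vstar)
    (hv : dimVector μ = t • vstar) :
    smallDelta g μ = 0 ∧ Rectangular μ ∧ n = lcmLength μ * t := by
  have himag : (cometQuiver g μ).IsPosImaginaryRoot vstar := (hb vstar).2 ⟨1, le_rfl, by simp⟩
  have hC := (himag.isFundamental haff.2.1).mulVec_eq_zero haff.2.1
  have hCv : (cometQuiver g μ).cartan.mulVec (dimVector μ) = 0 := by
    rw [hv, Matrix.mulVec_smul, hC, smul_zero]
  obtain ⟨hδ, hrect⟩ := (dimVector_radical_iff g hn).1 hCv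
  refine ⟨hδ, hrect, ?_⟩
  have hL : 0 < lcmLength μ := Nat.pos_of_dvd_of_pos (lcmLength_dvd μ hrect) hn
  obtain ⟨w, hw, hw0⟩ := exists_primitive hn hrect
  obtain ⟨hpos, hCw⟩ := primitive_pos_radical g hn hδ hrect hw
  -- The vector `w` is itself an imaginary root, so `v*_0` divides its central value `L`. Membership
  -- of `v*` in the radical gives the opposite divisibility.
  obtain ⟨s, _, hws⟩ := (hb w).1 (.fundamental w
    (FinQuiver.isFundamental_of_pos (comet_connected g) hpos hCw))
  have hdvd : (lcmLength μ : ℤ) ∣ vstar none := lcmLength_dvd_of_radical g hn hC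
  have h1 : (lcmLength μ : ℤ) = s * vstar none := by
    rw [← hw0, hws, Pi.smul_apply, nsmul_eq_mul]
  have hL' : (0 : ℤ) < lcmLength μ := by exact_mod_cast hL
  have h2 : 0 < vstar none := by
    rw [h1] at hL'
    exact pos_of_mul_pos_right hL' (Nat.cast_nonneg s)
  have h3 : vstar none = lcmLength μ :=
    Int.dvd_antisymm h2.le hL'.le (Dvd.intro_left _ h1.symm) hdvd
  have h4 := congrFun hv none
  rw [Pi.smul_apply, nsmul_eq_mul, h3] at h4
  have h5 : (n : ℤ) = t * lcmLength μ := h4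
  rw [mul_comm]
  exact_mod_cast h5

end SymFun

theorem theorem5p10 (g k n : ℕ) (μ : Fin k → n.Partition) (hδ : 0 ≤ SymFun.smallDelta g μ) :
    -- every `𝒜_{λμ}(q)` is nonzero, so that `v(λ)` is defined
    (∀ lam : n.Partition, SymFun.calA g μ lam ≠ 0) ∧
    -- the minimum of `v` is `v((1^n)) = -Δ(μ)`
    IsLeast (Set.range (SymFun.valuationA g μ)) (SymFun.valuationA g μ (SymFun.ones n)) ∧
    (SymFun.valuationA g μ (SymFun.ones n) : ℚ) = -SymFun.bigDelta g μ ∧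
    -- affine case
    (∀ (vstar : SymFun.CometVertex μ → ℤ) (t : ℕ), (SymFun.cometQuiver g μ).IsAffine →
      (SymFun.cometQuiver g μ).IsBasicImaginaryRoot vstar → 1 ≤ t →
      SymFun.dimVector μ = t • vstar →
        t ∣ n ∧ ∀ lam : n.Partition,
          (∀ κ : n.Partition, SymFun.valuationA g μ lam ≤ SymFun.valuationA g μ κ) ↔
            ∃ lam₀ : t.Partition, lam.parts = (n / t) • lam₀.parts) ∧
    -- all other cases
    (¬ ((SymFun.cometQuiver g μ).IsAffine ∧
        ∃ (vstar : SymFun.CometVertex μ → ℤ) (t : ℕ),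
          (SymFun.cometQuiver g μ).IsBasicImaginaryRoot vstar ∧ 1 ≤ t ∧
          SymFun.dimVector μ = t • vstar) →
      ∀ lam : n.Partition,
        (∀ κ : n.Partition, SymFun.valuationA g μ lam ≤ SymFun.valuationA g μ κ) ↔
          lam = SymFun.ones n) := by
  refine ⟨SymFun.calA_ne_zero g μ, ⟨⟨_, rfl⟩, ?_⟩, SymFun.valuationA_ones_eq g μ, ?_, ?_⟩
  · rintro _ ⟨lam, rfl⟩
    exact SymFun.valuationA_ones_le g μ lam hδ
  · intro vstar t haff hb ht hv
    -- For `n = 0` there is only one partition, and both sides hold.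
    rcases Nat.eq_zero_or_pos n with rfl | hn
    · refine ⟨dvd_zero t, fun lam => ⟨fun _ => ⟨SymFun.ones t, ?_⟩, fun _ κ => ?_⟩⟩
      · rw [Subsingleton.elim lam (SymFun.ones 0), SymFun.parts_ones]
        simp
      · rw [Subsingleton.elim lam κ]
    obtain ⟨hδ0, hrect, hnt⟩ := SymFun.rectangular_of_affine g hn haff hb hv
    have hdiv : n / t = SymFun.lcmLength μ := Nat.div_eq_of_eq_mul_left ht hnt
    refine ⟨Dvd.intro_left _ hnt.symm, fun lam => ?_⟩
    rw [SymFun.isMin_iff g μ lam hδ, hdiv]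
    exact SymFun.isMin_iff_copies g μ lam hn hδ0 hrect hnt
  · intro hnot lam
    rw [SymFun.isMin_iff g μ lam hδ]
    refine ⟨fun h => ?_, fun h => by rw [h]⟩
    rcases Nat.eq_zero_or_pos n with rfl | hn
    · exact Subsingleton.elim _ _
    by_contra hne
    obtain ⟨hδ0, hrect, -⟩ := SymFun.rectangular_of_isMin g μ lam hn hδ h hne
    -- A second minimizer would put `μ` in the affine case.
    exact hnot (SymFun.affine_of_rectangular g hn hδ0 hrect)
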